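/- Let $\mathcal F u_0(p)=\int_{\mathbb R}u_0(x)e^{-ixp}\,dx$ denote the Fourier transform, extended to tempered distributions. Let $p_1<p_2$ be real numbers, let $\mu\in(\tfrac12,1)$, and let $u_0$ be a tempered distribution on $\mathbb R$ whose Fourier transform $\mathcal F u_0$ is a function such that - $\mathcal F u_0=0$ on $\mathbb R\setminus[p_1,p_2]$; - $\mathcal F u_0(p)=(p-p_1)^{\mu-1}\,\tilde u(p)$ for all $p\in(p_1,p_2)$, where $\tilde u\in C^1([p_1,p_2],\mathbb C)$ and $\tilde u(p_1)\neq 0$; - $\mathcal F u_0$ is continuous on $(p_1,p_2]$ and $\mathcal F u_0(p_2)=0$. Then $u_0\in L^2(\mathbb R)$, and the free Schrödinger equation $i\,\partial_t u+\partial_x^2u=0$ $(t>0,\ x\in\mathbb R)$ with $u(0,\cdot)=u_0$ has a solution in $C([0,\infty);L^2(\mathbb R))$ (in the sense of tempered distributions in $x$: for every Schwartz function $\varphi$ and every $t>0$, $\frac{d}{dt}\langle u(t,\cdot),\varphi\rangle=i\langle\partial_x^2u(t,\cdot),\varphi\rangle$). Moreover, for all $\varepsilon_1,\varepsilon_2>0$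 with $p_1+\varepsilon_1<p_2-\varepsilon_2$ there is a constant $c=c(u_0,\varepsilon_1,\varepsilon_2)\ge 0$ such that every such solution $u$ satisfies, for all $t\ge 1$, $$\left|\,\|u(t,\cdot)\|_{L^2(I_t)}-\frac1{\sqrt{2\pi}}\,\|\mathcal F u_0\|_{L^2(p_1+\varepsilon_1,\,p_2-\varepsilon_2)}\right|\le c\,t^{\frac12-\mu},\qquad I_t:=\big[\,2(p_1+\varepsilon_1)t,\;2(p_2-\varepsilon_2)t\,\big].$$ -/

import Mathlib

open MeasureTheory SchwartzMap FourierTransform Set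
open scoped ENNReal

/-- `U : ℝ → ℂ` is (a representative of) the Fourier transform of the tempered distribution `u₀` in
the normalisation `(ℱ u₀)(p) = ∫ u₀(x) e^{-i x p} dx`.  Mathlib's Fourier transform `𝓕` has the kernel
`e^{-2 π i x ξ}`, so that `(ℱ u₀)(p) = (𝓕 u₀)(p / (2 π))`; hence the requirement is that the tempered
distribution `𝓕 u₀` is given by the function `ξ ↦ U (2 π ξ)`. -/
def IsAngularFourierTransform (u₀ : 𝓢'(ℝ, ℂ)) (U : ℝ → ℂ) : Prop :=
  ∀ φ : 𝓢(ℝ, ℂ), Integrable (fun ξ : ℝ => φ ξ * U (2 * Real.pi * ξ)) ∧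
    (𝓕 u₀) φ = ∫ ξ : ℝ, φ ξ * U (2 * Real.pi * ξ)

/-- Amplitudes on `(p₁, p₂)` with singularities of order `μ₁ - 1`, `μ₂ - 1` at the endpoints:
`U(p) = (p - p₁)^{μ₁ - 1} (p₂ - p)^{μ₂ - 1} ũ(p)` with `ũ` of class `C^N` on `[p₁, p₂]`, and
`ũ(p_j) ≠ 0` whenever `μ_j ≠ 1`. -/
def SingularAmplitude (p₁ p₂ μ₁ μ₂ : ℝ) (N : ℕ) (U : ℝ → ℂ) : Prop :=
  ∃ v : ℝ → ℂ, ContDiffOn ℝ N v (Icc p₁ p₂) ∧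
    (∀ p ∈ Ioo p₁ p₂, U p = (((p - p₁) ^ (μ₁ - 1) * (p₂ - p) ^ (μ₂ - 1) : ℝ) : ℂ) * v p) ∧
    (μ₁ ≠ 1 → v p₁ ≠ 0) ∧ (μ₂ ≠ 1 → v p₂ ≠ 0)

/-- The condition on the initial datum `u₀`, with `U = ℱ u₀`: `U` vanishes outside `[p₁, p₂]`, is an
amplitude with a singularity of order `μ - 1` at `p₁` and regular at `p₂`, and `U(p₂) = 0`.  Continuity
on `(p₁, p₂]` selects the natural representative, so that the value at the single point `p₂` has a
meaning. -/
structure FrequencyBandCondition (p₁ p₂ μ : ℝ) (u₀ : 𝓢'(ℝ, ℂ)) (U : ℝ → ℂ) : Prop where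
  fourier : IsAngularFourierTransform u₀ U
  eq_zero_outside : ∀ p, p ∉ Icc p₁ p₂ → U p = 0
  amplitude : SingularAmplitude p₁ p₂ μ 1 1 U
  continuousOn : ContinuousOn U (Ioc p₁ p₂)
  eq_zero_right : U p₂ = 0

/-- `u` is a solution in `C([0, ∞); L²(ℝ))` of the free Schrödinger equation
`i ∂ₜ u + ∂ₓ² u = 0` for `t > 0`, with initial value `u₀`; the spatial derivative is taken in the sense
of tempered distributions, and the time derivative after pairing with a Schwartz function.
Values of `u` at negative times play no role. -/
structure IsFreeSchrodingerSolution (u₀ : 𝓢'(ℝ, ℂ)) (u : ℝ → Lp ℂ 2 (volume : Measure ℝ)) :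
    Prop where
  continuousOn : ContinuousOn u (Ici 0)
  initial : (u 0 : 𝓢'(ℝ, ℂ)) = u₀
  equation : ∀ φ : 𝓢(ℝ, ℂ), ∀ t : ℝ, 0 < t →
    HasDerivAt (fun s : ℝ => (u s : 𝓢'(ℝ, ℂ)) φ)
      (Complex.I * TemperedDistribution.derivCLM ℂ
        (TemperedDistribution.derivCLM ℂ (u t : 𝓢'(ℝ, ℂ))) φ) t

/-- The `L²`-norm on the set `s` of a function `f : ℝ → ℂ`. -/
noncomputable def l2NormOn (s : Set ℝ) (f : ℝ → ℂ) : ℝ :=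
  (eLpNorm f 2 (volume.restrict s)).toReal

/-!
Let `G ξ = U (2 π ξ)` be the Fourier transform of `u₀` in Mathlib's normalisation. A singularity of
order `μ - 1 > -1/2` is square integrable, so `u₀` is in `L²`, and a curve in `L²` solves the
equation exactly when its Fourier transform is `e^{-i t (2 π ξ)²} G(ξ)`. This is a solution because
the symbol is bounded on the support of `G`; it is the only one because a weak solution, paired with
`e^{i t (2 π ξ)²} φ(ξ)` for a test function `φ`, has time derivative zero
(`ae_eq_phaseEvolution_of_weak_solution`).

Completing the square in `u(t, x) = (2 π)⁻¹ ∫ U(p) e^{i x p - i t p²} dp` gives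
`|u(t, 2 t q)| = (2 π)⁻¹ |∫ e^{-i t (p - q)²} U(p) dp|`, and the substitution `x = 2 t q` turns the
norm on `I_t` into a norm over the fixed interval `[p₁ + ε₁, p₂ - ε₂]` of stationary points `q`. The
leading term of this integral is `(π / (i t))^{1/2} U(q)`, which produces the limit. It remains to
bound the error in `L²(dq)` by `O(t^{-μ})`
(`FrequencyBandCondition.eLpNorm_gaussianConv_sub_le`). To this end split `U = A + B` at
`a = p₁ + ε₁ / 2`, where `A = U` to the right of `a` and `A` is linear on `[p₁, a]`.

* `A` is continuous (here `U(p₂) = 0` enters) and piecewise `C¹`, hence in `H¹`. The Fresnel kernel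
  is the Fourier multiplier `(π / (i t))^{1/2} e^{i π² ξ² / t}`, and `|e^{iθ} - 1| ≤ 2 |θ|^{1/2}`, so
  by Plancherel the error is `O(t^{-1/2} t^{-1/2})` (`eLpNorm_gaussianConv_sub_le`); this is
  `O(t^{-μ})` as `μ < 1`.
* `B` is supported in `[p₁, a]`, away from the stationary points. Integrating by parts at distance
  more than `1 / t` from `p₁` shows that it contributes `O(t^{-μ})` uniformly in `q`
  (`norm_integral_fresnel_le`).
-/

/-! ### The Fourier transform on `L¹ ∩ L²` -/

/-- Compactly supported Schwartz functions separate locally integrable functions. -/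
theorem ae_eq_of_forall_integral_schwartz_mul_eq {f g : ℝ → ℂ} (hf : LocallyIntegrable f)
    (hg : LocallyIntegrable g)
    (h : ∀ φ : 𝓢(ℝ, ℂ), HasCompactSupport φ → ∫ x, φ x * f x = ∫ x, φ x * g x) :
    f =ᵐ[volume] g := by
  refine ae_eq_of_integral_contDiff_smul_eq hf hg fun φ hφ hφc => ?_
  have h₁ : HasCompactSupport (Complex.ofRealCLM ∘ φ) := hφc.comp_left rfl
  have h₂ : ContDiff ℝ (⊤ : ℕ∞) (Complex.ofRealCLM ∘ φ) := by fun_prop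
  simpa using h (h₁.toSchwartzMap h₂) h₁

theorem continuous_fourier_of_integrable {f : ℝ → ℂ} (hf : Integrable f) : Continuous (𝓕 f) :=
  VectorFourier.fourierIntegral_continuous Real.continuous_fourierChar continuous_inner hf

/-- The Fourier transform on `L²`, defined by density, is the Fourier integral on `L¹ ∩ L²`. -/
theorem coeFn_fourier_toLp {f : ℝ → ℂ} (hf : Integrable f) (hf₂ : MemLp f 2) :
    (𝓕 hf₂.toLp : Lp ℂ 2 (volume : Measure ℝ)) =ᵐ[volume] 𝓕 f := by
  refine ae_eq_of_forall_integral_schwartz_mul_eq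
    ((Lp.memLp _).locallyIntegrable (by norm_num))
    (continuous_fourier_of_integrable hf).locallyIntegrable fun φ _ => ?_
  have h₁ := Lp.toTemperedDistribution_apply (𝓕 hf₂.toLp : Lp ℂ 2 (volume : Measure ℝ)) φ
  have h₂ : ∫ x, 𝓕 φ x • f x = ∫ x, φ x • 𝓕 f x := by
    simpa using! VectorFourier.integral_fourierIntegral_smul_eq_flip (L := innerₗ ℝ)
      Real.continuous_fourierChar continuous_inner φ.integrable hf
  rw [← Lp.fourier_toTemperedDistribution_eq, TemperedDistribution.fourier_apply,
    Lp.toTemperedDistribution_apply] at h₁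
  simp only [smul_eq_mul] at h₁ h₂
  rw [← h₁, ← h₂]
  refine integral_congr_ae ?_
  filter_upwards [hf₂.coeFn_toLp] with x hx
  rw [hx]

theorem coeFn_fourierInv_toLp {f : ℝ → ℂ} (hf : Integrable f) (hf₂ : MemLp f 2) :
    (𝓕⁻ hf₂.toLp : Lp ℂ 2 (volume : Measure ℝ)) =ᵐ[volume] 𝓕⁻ f := by
  have hc : Continuous (𝓕⁻ f) :=
    VectorFourier.fourierIntegral_continuous (L := -innerₗ ℝ) Real.continuous_fourierChar
      continuous_inner.neg hf
  refine ae_eq_of_forall_integral_schwartz_mul_eq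
    ((Lp.memLp _).locallyIntegrable (by norm_num)) hc.locallyIntegrable fun φ _ => ?_
  have h₁ := Lp.toTemperedDistribution_apply (𝓕⁻ hf₂.toLp : Lp ℂ 2 (volume : Measure ℝ)) φ
  have h₂ : ∫ x, 𝓕⁻ (φ : ℝ → ℂ) x • f x = ∫ x, φ x • 𝓕⁻ f x := by
    have hflip : (-innerₗ ℝ : ℝ →ₗ[ℝ] ℝ →ₗ[ℝ] ℝ).flip = -innerₗ ℝ := by
      ext; simp
    simpa [hflip] using! VectorFourier.integral_fourierIntegral_smul_eq_flip (L := -innerₗ ℝ)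
      Real.continuous_fourierChar continuous_inner.neg (φ.integrable (μ := volume)) hf
  rw [← Lp.fourierInv_toTemperedDistribution_eq, TemperedDistribution.fourierInv_apply,
    Lp.toTemperedDistribution_apply] at h₁
  simp only [smul_eq_mul] at h₁ h₂
  rw [← h₁, ← h₂]
  refine integral_congr_ae ?_
  filter_upwards [hf₂.coeFn_toLp] with x hx
  rw [hx, fourierInv_coe]

/-- **Plancherel's theorem** on `L¹ ∩ L²`. -/
theorem eLpNorm_fourierInv_eq {f : ℝ → ℂ} (hf : Integrable f) (hf₂ : MemLp f 2) :
    eLpNorm (𝓕⁻ f) 2 volume = eLpNorm f 2 volume := by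
  rw [← eLpNorm_congr_ae (coeFn_fourierInv_toLp hf hf₂), ← Lp.enorm_def,
    ← eLpNorm_congr_ae hf₂.coeFn_toLp, ← Lp.enorm_def]
  have : ‖(𝓕⁻ hf₂.toLp : Lp ℂ 2 (volume : Measure ℝ))‖ = ‖hf₂.toLp‖ :=
    (Lp.fourierTransformₗᵢ ℝ ℂ).symm.norm_map _
  rw [← ofReal_norm, ← ofReal_norm, this]

theorem memLp_fourier {f : ℝ → ℂ} (hf : Integrable f) (hf₂ : MemLp f 2) : MemLp (𝓕 f) 2 :=
  (memLp_congr_ae (coeFn_fourier_toLp hf hf₂)).1 (Lp.memLp _)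

theorem toTemperedDistribution_injective {f g : Lp ℂ 2 (volume : Measure ℝ)}
    (h : (f : 𝓢'(ℝ, ℂ)) = g) : f = g :=
  LinearMap.ker_eq_bot.1 (Lp.ker_toTemperedDistributionCLM_eq_bot (E := ℝ) (F := ℂ)
    (μ := volume) (p := 2)) h

/-! ### Evolution by a real Fourier symbol, and weak uniqueness -/

/-- The function `ξ ↦ e^{i t m(ξ)} g(ξ)`, the evolution of `g` at time `t` under the Fourier multiplier
with real symbol `m`, seen on the Fourier side. -/
noncomputable def phaseEvolution (m : ℝ → ℝ) (g : ℝ → ℂ) (t : ℝ) : ℝ → ℂ :=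
  fun ξ => Complex.exp (Complex.I * (t * m ξ : ℝ)) * g ξ

theorem norm_phaseEvolution (m : ℝ → ℝ) (g : ℝ → ℂ) (t ξ : ℝ) :
    ‖phaseEvolution m g t ξ‖ = ‖g ξ‖ := by
  rw [phaseEvolution, norm_mul, mul_comm Complex.I, Complex.norm_exp_ofReal_mul_I, one_mul]

theorem memLp_phaseEvolution {m : ℝ → ℝ} {g : ℝ → ℂ} {p : ℝ≥0∞} (hm : Continuous m)
    (hg : MemLp g p) (t : ℝ) : MemLp (phaseEvolution m g t) p := by
  refine hg.of_le ?_ (Filter.Eventually.of_forall fun ξ => (norm_phaseEvolution m g t ξ).le)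
  exact (Continuous.aestronglyMeasurable (by fun_prop)).mul hg.1

/-- If the symbol `m` is bounded on the support of `g`, then `t ↦ e^{i t m} g` is differentiable
as a curve in `L²`. -/
theorem hasDerivAt_toLp_phaseEvolution {m : ℝ → ℝ} {g : ℝ → ℂ} {M : ℝ} (hm : Continuous m)
    (hg : MemLp g 2) (hg' : MemLp (fun ξ => Complex.I * m ξ * g ξ) 2)
    (hM : ∀ ξ, g ξ ≠ 0 → |m ξ| ≤ M) (t : ℝ) :
    HasDerivAt (fun s => (memLp_phaseEvolution hm hg s).toLp)
      (memLp_phaseEvolution hm hg' t).toLp t := by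
  have hM1 : 0 < |M| + 1 := by positivity
  rw [hasDerivAt_iff_isLittleO]
  refine Asymptotics.IsBigO.trans_isLittleO (g := fun s => (s - t) ^ 2) ?_ ?_
  · refine Asymptotics.IsBigO.of_bound ((|M| + 1) ^ 2 * ‖hg.toLp‖) ?_
    filter_upwards [Metric.ball_mem_nhds t (inv_pos.2 hM1)] with s hs
    rw [Metric.mem_ball, Real.dist_eq] at hs
    have hs' : |s - t| * (|M| + 1) ≤ 1 := by
      have := mul_le_mul_of_nonneg_right hs.le hM1.le
      rwa [inv_mul_cancel₀ hM1.ne'] at this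
    have key : ‖(memLp_phaseEvolution hm hg s).toLp - (memLp_phaseEvolution hm hg t).toLp -
        (s - t) • (memLp_phaseEvolution hm hg' t).toLp‖ ≤
        ((s - t) ^ 2 * (|M| + 1) ^ 2) * ‖hg.toLp‖ := by
      refine Lp.norm_le_mul_norm_of_ae_le_mul ?_
      filter_upwards [(memLp_phaseEvolution hm hg s).coeFn_toLp,
        (memLp_phaseEvolution hm hg t).coeFn_toLp, (memLp_phaseEvolution hm hg' t).coeFn_toLp,
        hg.coeFn_toLp, Lp.coeFn_sub ((memLp_phaseEvolution hm hg s).toLp -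
          (memLp_phaseEvolution hm hg t).toLp) ((s - t) • (memLp_phaseEvolution hm hg' t).toLp),
        Lp.coeFn_sub (memLp_phaseEvolution hm hg s).toLp (memLp_phaseEvolution hm hg t).toLp,
        Lp.coeFn_smul (s - t) (memLp_phaseEvolution hm hg' t).toLp] with ξ h₁ h₂ h₃ h₄ h₅ h₆ h₇
      rw [h₅, Pi.sub_apply, h₆, Pi.sub_apply, h₇, Pi.smul_apply, h₁, h₂, h₃, h₄]
      by_cases h0 : g ξ = 0
      · simp [phaseEvolution, h0]
      set z : ℂ := Complex.I * ((s - t) * m ξ : ℝ) with hz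
      have e : phaseEvolution m g s ξ - phaseEvolution m g t ξ -
          (s - t) • phaseEvolution m (fun ξ => Complex.I * m ξ * g ξ) t ξ =
          phaseEvolution m g t ξ * (Complex.exp z - 1 - z) := by
        have : Complex.exp (Complex.I * (s * m ξ : ℝ)) =
            Complex.exp (Complex.I * (t * m ξ : ℝ)) * Complex.exp z := by
          rw [← Complex.exp_add, hz]; congr 1; push_cast; ring
        simp only [phaseEvolution, this, Complex.real_smul, hz]
        push_cast; ring
      have hzn : ‖z‖ ≤ |s - t| * (|M| + 1) := by
        rw [hz, norm_mul, Complex.norm_I, one_mul, Complex.norm_real, Real.norm_eq_abs, abs_mul]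
        gcongr
        linarith [hM ξ h0, le_abs_self M]
      rw [e, norm_mul, norm_phaseEvolution, mul_comm]
      refine mul_le_mul_of_nonneg_right ?_ (norm_nonneg _)
      calc _ ≤ ‖z‖ ^ 2 := Complex.norm_exp_sub_one_sub_id_le (hzn.trans hs')
        _ ≤ (|s - t| * (|M| + 1)) ^ 2 := by gcongr
        _ = _ := by rw [mul_pow, sq_abs]
    refine key.trans (le_of_eq ?_)
    rw [norm_pow, Real.norm_eq_abs, sq_abs]; ring
  · have h : Filter.Tendsto (fun s : ℝ => s - t) (nhds t) (nhds 0) := by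
      have : Continuous fun s : ℝ => s - t := by fun_prop
      simpa using this.tendsto t
    simpa [pow_two] using
      ((Asymptotics.isLittleO_one_iff ℝ).2 h).mul_isBigO
        (Asymptotics.isBigO_refl (fun s : ℝ => s - t) (nhds t))

theorem inner_toLp_eq_integral {g : ℝ → ℂ} (hg : MemLp g 2) (w : Lp ℂ 2 (volume : Measure ℝ)) :
    inner ℂ hg.toLp w = ∫ ξ, starRingEnd ℂ (g ξ) * w ξ := by
  rw [L2.inner_def]
  refine integral_congr_ae ?_
  filter_upwards [hg.coeFn_toLp] with ξ h
  rw [h, RCLike.inner_apply, mul_comm]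

/-- The derivative of a pairing of two curves in a Hilbert space, where the second curve is only
continuous, and differentiable after pairing with the value of the first one. -/
theorem hasDerivAt_inner_of_weak {H : Type*} [NormedAddCommGroup H] [InnerProductSpace ℂ H]
    {Ψ w : ℝ → H} {Ψ' : H} {t : ℝ} {d : ℂ} (hΨ : HasDerivAt Ψ Ψ' t) (hw : ContinuousAt w t)
    (hd : HasDerivAt (fun s => inner ℂ (Ψ t) (w s)) d t) :
    HasDerivAt (fun s => inner ℂ (Ψ s) (w s)) (inner ℂ Ψ' (w t) + d) t := by
  rw [hasDerivAt_iff_tendsto_slope] at hΨ hd ⊢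
  have h : Filter.Tendsto (fun s => inner ℂ (slope Ψ t s) (w s)) (nhdsWithin t {t}ᶜ)
      (nhds (inner ℂ Ψ' (w t))) := hΨ.inner (hw.tendsto.mono_left nhdsWithin_le_nhds)
  refine (h.add hd).congr fun s => ?_
  simp only [slope_def_module, ← inner_sub_right]
  rw [← Complex.coe_smul, inner_smul_left, inner_sub_left, inner_sub_right]
  simp
  ring

/-- Uniqueness for the equation `∂ₜ w = -i m w` in the weak sense: a continuous curve in `L²` that
solves it after pairing with test functions is `e^{-i t m} w(0)`. -/
theorem ae_eq_phaseEvolution_of_weak_solution {m : ℝ → ℝ} (hm : ContDiff ℝ (⊤ : ℕ∞) m)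
    {w : ℝ → Lp ℂ 2 (volume : Measure ℝ)} (hw : ContinuousOn w (Ici 0))
    (h : ∀ φ : 𝓢(ℝ, ℂ), HasCompactSupport φ → ∀ t, 0 < t →
      HasDerivAt (fun s => ∫ ξ, φ ξ * w s ξ) (-(Complex.I * ∫ ξ, m ξ * φ ξ * w t ξ)) t)
    {t : ℝ} (ht : 0 ≤ t) :
    w t =ᵐ[volume] phaseEvolution m (w 0) (-t) := by
  have hm0 : Continuous m := hm.continuous
  have hw2 : MemLp (phaseEvolution m (w t) t) 2 := memLp_phaseEvolution hm0 (Lp.memLp _) t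
  suffices H : phaseEvolution m (w t) t =ᵐ[volume] w 0 by
    filter_upwards [H] with ξ hξ
    rw [phaseEvolution, ← hξ, phaseEvolution, ← mul_assoc, ← Complex.exp_add]
    simp
  refine ae_eq_of_forall_integral_schwartz_mul_eq (hw2.locallyIntegrable (by norm_num))
    ((Lp.memLp _).locallyIntegrable (by norm_num)) fun φ hφ => ?_
  set g : ℝ → ℂ := fun ξ => starRingEnd ℂ (φ ξ)
  have hgc : Continuous g := Complex.continuous_conj.comp φ.continuous
  have hgs : HasCompactSupport g := hφ.comp_left (map_zero _)
  have hg : MemLp g 2 := hgc.memLp_of_hasCompactSupport hgs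
  have hmn : Continuous fun ξ => -m ξ := hm0.neg
  have hg' : MemLp (fun ξ => Complex.I * (-m ξ : ℝ) * g ξ) 2 :=
    Continuous.memLp_of_hasCompactSupport (by fun_prop) hgs.mul_left
  obtain ⟨M, hM⟩ : ∃ M, ∀ ξ, g ξ ≠ 0 → |-m ξ| ≤ M := by
    obtain ⟨M, hM⟩ := hgs.isCompact.exists_bound_of_continuousOn hmn.continuousOn
    exact ⟨M, fun ξ hξ => hM ξ (subset_tsupport _ hξ)⟩
  have hΨ := hasDerivAt_toLp_phaseEvolution hmn hg hg' hM
  set Ψ : ℝ → Lp ℂ 2 (volume : Measure ℝ) := fun s => (memLp_phaseEvolution hmn hg s).toLp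
  have hpair : ∀ (s : ℝ) (v : Lp ℂ 2 (volume : Measure ℝ)), inner ℂ (Ψ s) v =
      ∫ ξ, (Complex.exp (Complex.I * (s * m ξ : ℝ)) * φ ξ) * v ξ := by
    intro s v
    rw [inner_toLp_eq_integral]
    refine integral_congr_ae (Filter.Eventually.of_forall fun ξ => ?_)
    simp only [phaseEvolution, g, map_mul, ← Complex.exp_conj, Complex.conj_I, Complex.conj_ofReal,
      Complex.conj_conj]
    congr 3
    push_cast; ring
  have hder : ∀ s, 0 < s → HasDerivAt (fun r => inner ℂ (Ψ r) (w r)) 0 s := by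
    intro s hs
    have hsm : ContDiff ℝ (⊤ : ℕ∞)
        fun ξ : ℝ => Complex.exp (Complex.I * (s * m ξ : ℝ)) * φ ξ := by
      have h1 : ContDiff ℝ (⊤ : ℕ∞) fun ξ : ℝ => ((s * m ξ : ℝ) : ℂ) :=
        Complex.ofRealCLM.contDiff.comp (contDiff_const.mul hm)
      exact (contDiff_const.mul h1).cexp.mul (φ.smooth _)
    have hcs : HasCompactSupport
        fun ξ : ℝ => Complex.exp (Complex.I * (s * m ξ : ℝ)) * φ ξ := hφ.mul_left
    have hd := h (hcs.toSchwartzMap hsm) hcs s hs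
    have hd' : HasDerivAt (fun r => inner ℂ (Ψ s) (w r))
        (-(Complex.I * ∫ ξ, m ξ * (Complex.exp (Complex.I * (s * m ξ : ℝ)) * φ ξ) * w s ξ)) s := by
      simp only [hpair]
      exact hd
    convert hasDerivAt_inner_of_weak (hΨ s) ((hw s hs.le).continuousAt (Ici_mem_nhds hs)) hd' using 1
    rw [inner_toLp_eq_integral, ← integral_const_mul, ← sub_eq_add_neg, eq_comm, sub_eq_zero]
    refine integral_congr_ae (Filter.Eventually.of_forall fun ξ => ?_)
    simp only [phaseEvolution, g, map_mul, ← Complex.exp_conj, Complex.conj_I, Complex.conj_ofReal,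
      Complex.conj_conj]
    have : -Complex.I * ((s * -m ξ : ℝ) : ℂ) = Complex.I * (s * m ξ : ℝ) := by push_cast; ring
    rw [this]
    push_cast; ring
  have hcont : ContinuousOn (fun r => inner ℂ (Ψ r) (w r)) (Icc 0 t) := by
    have : Continuous Ψ := continuous_iff_continuousAt.2 fun s => (hΨ s).continuousAt
    exact this.continuousOn.inner ((hw.mono Icc_subset_Ici_self))
  have hconst := intervalIntegral.integral_eq_sub_of_hasDerivAt_of_le ht hcont
    (fun s hs => hder s hs.1) (by simp)
  simp only [intervalIntegral.integral_zero] at hconst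
  have := sub_eq_zero.1 hconst.symm
  rw [hpair, hpair] at this
  simp only [zero_mul, Complex.ofReal_zero, mul_zero, Complex.exp_zero, one_mul] at this
  rw [← this]
  refine integral_congr_ae (Filter.Eventually.of_forall fun ξ => ?_)
  simp only [phaseEvolution]
  ring

/-! ### Solutions of the free Schrödinger equation -/

theorem derivCLM_fourier_eq (ψ : 𝓢(ℝ, ℂ)) :
    SchwartzMap.derivCLM ℂ ℂ (𝓕 ψ) =
      𝓕 (SchwartzMap.smulLeftCLM ℂ (fun x : ℝ => (-2 * Real.pi * Complex.I * x : ℂ)) ψ) := by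
  have hg : Function.HasTemperateGrowth (fun x : ℝ => (-2 * Real.pi * Complex.I * x : ℂ)) := by
    fun_prop
  have hx : Integrable (fun x : ℝ => x • ψ x) := by
    have h := (ψ.integrable_pow_mul volume 1)
    refine h.mono' (by fun_prop) (Filter.Eventually.of_forall fun x => ?_)
    simp
  ext x
  rw [SchwartzMap.derivCLM_apply, fourier_coe, fourier_coe, Real.deriv_fourier ψ.integrable hx]
  rw [SchwartzMap.smulLeftCLM_apply hg]

/-- The symbol of `-∂ₓ²` in the frequency variable of Mathlib's Fourier transform. -/
noncomputable def laplaceSymbol (ξ : ℝ) : ℝ := (2 * Real.pi * ξ) ^ 2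

theorem contDiff_laplaceSymbol : ContDiff ℝ (⊤ : ℕ∞) laplaceSymbol := by
  unfold laplaceSymbol
  fun_prop

theorem toTemperedDistribution_apply_fourier (v : Lp ℂ 2 (volume : Measure ℝ)) (ψ : 𝓢(ℝ, ℂ)) :
    (v : 𝓢'(ℝ, ℂ)) (𝓕 ψ) = ∫ ξ, ψ ξ * (𝓕 v : Lp ℂ 2 (volume : Measure ℝ)) ξ := by
  rw [← TemperedDistribution.fourier_apply, Lp.fourier_toTemperedDistribution_eq,
    Lp.toTemperedDistribution_apply]
  rfl

theorem deriv_deriv_toTemperedDistribution_apply_fourier (v : Lp ℂ 2 (volume : Measure ℝ))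
    (ψ : 𝓢(ℝ, ℂ)) :
    TemperedDistribution.derivCLM ℂ (TemperedDistribution.derivCLM ℂ (v : 𝓢'(ℝ, ℂ))) (𝓕 ψ) =
      -∫ ξ, laplaceSymbol ξ * ψ ξ * (𝓕 v : Lp ℂ 2 (volume : Measure ℝ)) ξ := by
  have hg : Function.HasTemperateGrowth (fun x : ℝ => (-2 * Real.pi * Complex.I * x : ℂ)) := by
    fun_prop
  rw [TemperedDistribution.derivCLM_apply_apply, TemperedDistribution.derivCLM_apply_apply,
    map_neg, map_neg, map_neg, neg_neg, derivCLM_fourier_eq, derivCLM_fourier_eq,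
    toTemperedDistribution_apply_fourier, ← integral_neg]
  refine integral_congr_ae (Filter.Eventually.of_forall fun ξ => ?_)
  simp only [SchwartzMap.smulLeftCLM_apply_apply hg, smul_eq_mul, laplaceSymbol]
  push_cast
  linear_combination (2 * Real.pi * ξ : ℂ) ^ 2 * ψ ξ *
    (𝓕 v : Lp ℂ 2 (volume : Measure ℝ)) ξ * Complex.I_sq

/-- An `L²` density representing `𝓕 u₀` identifies it as an element of `L²`. -/
theorem fourier_eq_toLp {u₀ : 𝓢'(ℝ, ℂ)} {U : ℝ → ℂ} (hU : IsAngularFourierTransform u₀ U)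
    (hG : MemLp (fun ξ => U (2 * Real.pi * ξ)) 2) :
    𝓕 u₀ = (hG.toLp : 𝓢'(ℝ, ℂ)) := by
  ext φ
  rw [(hU φ).2, Lp.toTemperedDistribution_apply]
  refine integral_congr_ae ?_
  filter_upwards [hG.coeFn_toLp] with ξ h
  rw [h, smul_eq_mul]

theorem fourierInv_toLp_eq {u₀ : 𝓢'(ℝ, ℂ)} {U : ℝ → ℂ} (hU : IsAngularFourierTransform u₀ U)
    (hG : MemLp (fun ξ => U (2 * Real.pi * ξ)) 2) :
    ((𝓕⁻ hG.toLp : Lp ℂ 2 (volume : Measure ℝ)) : 𝓢'(ℝ, ℂ)) = u₀ := by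
  rw [← Lp.fourierInv_toTemperedDistribution_eq, ← fourier_eq_toLp hU hG, fourierInv_fourier_eq]

/-- Every solution is given by the free propagator on the Fourier side; in particular solutions are
unique. -/
theorem IsFreeSchrodingerSolution.fourier_ae_eq {u₀ : 𝓢'(ℝ, ℂ)} {U : ℝ → ℂ}
    {u : ℝ → Lp ℂ 2 (volume : Measure ℝ)} (hu : IsFreeSchrodingerSolution u₀ u)
    (hU : IsAngularFourierTransform u₀ U)
    (hG : MemLp (fun ξ => U (2 * Real.pi * ξ)) 2) {t : ℝ} (ht : 0 ≤ t) :
    (𝓕 (u t) : Lp ℂ 2 (volume : Measure ℝ)) =ᵐ[volume]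
      phaseEvolution laplaceSymbol (fun ξ => U (2 * Real.pi * ξ)) (-t) := by
  have h0 : (𝓕 (u 0) : Lp ℂ 2 (volume : Measure ℝ)) = hG.toLp := by
    apply toTemperedDistribution_injective
    rw [← fourier_eq_toLp hU hG, ← hu.initial, Lp.fourier_toTemperedDistribution_eq]
  have hc : ContinuousOn (fun s => (𝓕 (u s) : Lp ℂ 2 (volume : Measure ℝ))) (Ici 0) :=
    (Lp.fourierTransformₗᵢ ℝ ℂ).continuous.comp_continuousOn hu.continuousOn
  have h := ae_eq_phaseEvolution_of_weak_solution contDiff_laplaceSymbol hc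
    (fun φ _ s hs => by
      have := hu.equation (𝓕 φ) s hs
      simp only [toTemperedDistribution_apply_fourier,
        deriv_deriv_toTemperedDistribution_apply_fourier, mul_neg] at this
      exact this) ht
  rw [h0] at h
  refine h.trans ?_
  filter_upwards [hG.coeFn_toLp] with ξ hξ
  rw [phaseEvolution, hξ, phaseEvolution]

theorem IsFreeSchrodingerSolution.ae_eq_fourierInv {u₀ : 𝓢'(ℝ, ℂ)} {U : ℝ → ℂ}
    {u : ℝ → Lp ℂ 2 (volume : Measure ℝ)} (hu : IsFreeSchrodingerSolution u₀ u)
    (hU : IsAngularFourierTransform u₀ U)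
    (hG : MemLp (fun ξ => U (2 * Real.pi * ξ)) 2)
    (hG₁ : Integrable (fun ξ => U (2 * Real.pi * ξ))) {t : ℝ} (ht : 0 ≤ t) :
    u t =ᵐ[volume] 𝓕⁻ (phaseEvolution laplaceSymbol (fun ξ => U (2 * Real.pi * ξ)) (-t)) := by
  have hm := contDiff_laplaceSymbol.continuous
  have h2 := memLp_phaseEvolution hm hG (-t)
  have h1 := memLp_one_iff_integrable.1 (memLp_phaseEvolution hm
    (memLp_one_iff_integrable.2 hG₁) (-t))
  have h : (𝓕 (u t) : Lp ℂ 2 (volume : Measure ℝ)) = h2.toLp :=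
    Lp.ext ((hu.fourier_ae_eq hU hG ht).trans h2.coeFn_toLp.symm)
  have h' : u t = 𝓕⁻ h2.toLp := by rw [← h, fourierInv_fourier_eq]
  rw [h']
  exact coeFn_fourierInv_toLp h1 h2

/-- For bounded frequencies the propagator is differentiable in time as a curve in `L²`, so no
regularisation is needed to see that it solves the equation. -/
theorem exists_isFreeSchrodingerSolution {u₀ : 𝓢'(ℝ, ℂ)} {U : ℝ → ℂ} {R : ℝ}
    (hU : IsAngularFourierTransform u₀ U)
    (hG : MemLp (fun ξ => U (2 * Real.pi * ξ)) 2) (hR : ∀ p, U p ≠ 0 → |p| ≤ R) :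
    ∃ u : ℝ → Lp ℂ 2 (volume : Measure ℝ), IsFreeSchrodingerSolution u₀ u := by
  set G : ℝ → ℂ := fun ξ => U (2 * Real.pi * ξ) with hGdef
  have hm : Continuous fun ξ => -laplaceSymbol ξ := contDiff_laplaceSymbol.continuous.neg
  have hM : ∀ ξ, G ξ ≠ 0 → |-laplaceSymbol ξ| ≤ R ^ 2 := by
    intro ξ hξ
    rw [abs_neg, laplaceSymbol, abs_pow]
    exact pow_le_pow_left₀ (abs_nonneg _) (hR _ hξ) 2
  have hG' : MemLp (fun ξ => Complex.I * (-laplaceSymbol ξ : ℝ) * G ξ) 2 := by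
    refine hG.of_le_mul (c := R ^ 2) ?_ (Filter.Eventually.of_forall fun ξ => ?_)
    · exact (Continuous.aestronglyMeasurable (by fun_prop)).mul hG.1
    · by_cases h : G ξ = 0
      · simp [h]
      · rw [norm_mul, norm_mul, Complex.norm_I, one_mul, Complex.norm_real, Real.norm_eq_abs]
        exact mul_le_mul_of_nonneg_right (hM ξ h) (norm_nonneg _)
  have hΨ := hasDerivAt_toLp_phaseEvolution hm hG hG' hM
  set Ψ : ℝ → Lp ℂ 2 (volume : Measure ℝ) := fun s => (memLp_phaseEvolution hm hG s).toLp
    with hΨdef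
  refine ⟨fun s => 𝓕⁻ (Ψ s), ?_, ?_, ?_⟩
  · have : Continuous Ψ := continuous_iff_continuousAt.2 fun s => (hΨ s).continuousAt
    exact ((Lp.fourierTransformₗᵢ ℝ ℂ).symm.continuous.comp this).continuousOn
  · have : Ψ 0 = hG.toLp := by
      refine Lp.ext ?_
      filter_upwards [hG.coeFn_toLp, (memLp_phaseEvolution hm hG 0).coeFn_toLp] with ξ h₁ h₂
      rw [h₁, h₂]
      simp [phaseEvolution, hGdef]
    simp only [this]
    exact fourierInv_toLp_eq hU hG
  · intro φ t ht
    obtain ⟨ψ, rfl⟩ : ∃ ψ : 𝓢(ℝ, ℂ), 𝓕 ψ = φ := ⟨𝓕⁻ φ, fourier_fourierInv_eq φ⟩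
    simp only [toTemperedDistribution_apply_fourier,
      deriv_deriv_toTemperedDistribution_apply_fourier, fourier_fourierInv_eq]
    have hψ : MemLp (fun ξ => starRingEnd ℂ (ψ ξ)) 2 :=
      (ψ.memLp 2 volume).of_le
        (Complex.continuous_conj.comp ψ.continuous).aestronglyMeasurable
        (Filter.Eventually.of_forall fun ξ => by simp)
    have h := (hasDerivAt_const t hψ.toLp).inner ℂ (hΨ t)
    simp only [inner_toLp_eq_integral, Complex.conj_conj, inner_zero_left, add_zero] at h
    refine h.congr_deriv ?_
    rw [mul_neg, ← integral_const_mul, ← integral_neg]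
    refine integral_congr_ae ?_
    filter_upwards [(memLp_phaseEvolution hm hG t).coeFn_toLp,
      (memLp_phaseEvolution hm hG' t).coeFn_toLp] with ξ h₁ h₂
    simp only [hΨdef]
    rw [h₁, h₂]
    simp only [phaseEvolution]
    push_cast
    ring

/-! ### Fresnel integrals of `H¹` amplitudes -/

/-- The convolution `∫ e^{-z (p - q)²} f(p) dp` of `f` with the complex Gaussian of parameter `z`;
for `z = i t` this is a Fresnel integral with stationary point `q`. -/
noncomputable def gaussianConv (z : ℂ) (f : ℝ → ℂ) (q : ℝ) : ℂ :=
  ∫ p : ℝ, Complex.exp (-z * (p - q) ^ 2) * f p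

theorem gaussianConv_eq_fourierInv_of_re_pos {z : ℂ} (hz : 0 < z.re) {f : ℝ → ℂ}
    (hf : Integrable f) (q : ℝ) :
    gaussianConv z f q = (Real.pi / z) ^ (1 / 2 : ℂ) *
      𝓕⁻ (fun ξ : ℝ => Complex.exp (-(Real.pi * ξ) ^ 2 / z) * 𝓕 f ξ) q := by
  have hz0 : z ≠ 0 := by rintro rfl; simp at hz
  have hπ : (Real.pi : ℂ) ≠ 0 := by exact_mod_cast Real.pi_ne_zero
  set b : ℂ := Real.pi / z with hb
  have hb0 : b ≠ 0 := div_ne_zero hπ hz0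
  have hbre : 0 < b.re := by
    rw [hb, Complex.div_re]
    have := Complex.normSq_pos.2 hz0
    simp only [Complex.ofReal_re, Complex.ofReal_im, zero_mul, zero_div, add_zero]
    positivity
  have hg : Integrable fun x : ℝ =>
      Complex.exp (-Real.pi * b * x ^ 2 + 2 * Real.pi * (Complex.I * q) * x) := by
    have h := integrable_cexp_quadratic (b := Real.pi * b) (by
      rw [Complex.re_ofReal_mul]; positivity) (2 * Real.pi * (Complex.I * q)) 0
    simpa using h
  have hF := fourier_gaussian_pi' hbre (Complex.I * q)
  have h : ∫ ξ, 𝓕 f ξ • Complex.exp (-Real.pi * b * ξ ^ 2 + 2 * Real.pi * (Complex.I * q) * ξ) =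
      ∫ p, f p • 𝓕 (fun x : ℝ =>
        Complex.exp (-Real.pi * b * x ^ 2 + 2 * Real.pi * (Complex.I * q) * x)) p := by
    simpa using! VectorFourier.integral_fourierIntegral_smul_eq_flip (L := innerₗ ℝ)
      Real.continuous_fourierChar continuous_inner hf hg
  have hb2 : b ^ (1 / 2 : ℂ) ≠ 0 := by simp [Complex.cpow_eq_zero_iff, hb0]
  rw [hF] at h
  rw [gaussianConv, Real.fourierInv_eq']
  have e₁ : ∀ ξ : ℝ, Complex.exp (↑(2 * Real.pi * inner ℝ ξ q) * Complex.I) •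
      (Complex.exp (-(Real.pi * ξ) ^ 2 / z) * 𝓕 f ξ) =
      𝓕 f ξ • Complex.exp (-Real.pi * b * ξ ^ 2 + 2 * Real.pi * (Complex.I * q) * ξ) := by
    intro ξ
    simp only [smul_eq_mul, ← mul_assoc, ← Complex.exp_add]
    rw [mul_comm]
    congr 2
    simp only [RCLike.inner_apply, conj_trivial, hb]
    push_cast
    ring
  rw [integral_congr_ae (Filter.Eventually.of_forall e₁), h, ← integral_const_mul]
  refine integral_congr_ae (Filter.Eventually.of_forall fun p => ?_)
  have e₂ : -(Real.pi : ℂ) / b * (p + Complex.I * (Complex.I * q)) ^ 2 = -z * (p - q) ^ 2 := by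
    rw [← mul_assoc, Complex.I_mul_I, hb]
    field_simp
    ring
  simp only [smul_eq_mul, e₂]
  field_simp

theorem norm_exp_neg_sq_div_le {z : ℂ} (hz : 0 ≤ z.re) (x : ℝ) :
    ‖Complex.exp (-(x : ℂ) ^ 2 / z)‖ ≤ 1 := by
  rw [Complex.norm_exp, Real.exp_le_one_iff, neg_div, Complex.neg_re, neg_nonpos,
    ← Complex.ofReal_pow, Complex.div_re]
  simp only [Complex.ofReal_re, Complex.ofReal_im, zero_mul, zero_div, add_zero]
  have := Complex.normSq_nonneg z
  positivity

/-- The Fresnel integral as a Fourier multiplier: convolution with `e^{-i t p²}` multiplies the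
Fourier transform by `(π / (i t))^{1/2} e^{i π² ξ² / t}`. -/
theorem gaussianConv_eq_fourierInv {t : ℝ} (ht : 0 < t) {f : ℝ → ℂ}
    (hf : Integrable f) (hf' : Integrable (𝓕 f)) (q : ℝ) :
    gaussianConv (Complex.I * t) f q = (Real.pi / (Complex.I * t)) ^ (1 / 2 : ℂ) *
      𝓕⁻ (fun ξ : ℝ => Complex.exp (-(Real.pi * ξ) ^ 2 / (Complex.I * t)) * 𝓕 f ξ) q := by
  -- The identity holds for `z = ε + i t` with `ε > 0`; both sides converge as `ε → 0`.
  have hz0 : (Complex.I * t : ℂ) ≠ 0 :=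
    mul_ne_zero Complex.I_ne_zero (by exact_mod_cast ht.ne')
  have hπ : (Real.pi : ℂ) ≠ 0 := by exact_mod_cast Real.pi_ne_zero
  set z : ℝ → ℂ := fun ε => ε + Complex.I * t with hzdef
  have hzre : ∀ ε, (z ε).re = ε := fun ε => by simp [hzdef]
  have hzt : Filter.Tendsto z (nhdsWithin 0 (Ioi 0)) (nhds (Complex.I * t)) := by
    have : Continuous z := by fun_prop
    have h := (this.tendsto 0).mono_left (nhdsWithin_le_nhds (s := Ioi 0))
    simpa [hzdef] using h
  have hpos : ∀ᶠ ε in nhdsWithin (0 : ℝ) (Ioi 0), 0 < ε := self_mem_nhdsWithin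
  have hL : Filter.Tendsto (fun ε => gaussianConv (z ε) f q) (nhdsWithin 0 (Ioi 0))
      (nhds (gaussianConv (Complex.I * t) f q)) := by
    unfold gaussianConv
    refine tendsto_integral_filter_of_dominated_convergence (fun p => ‖f p‖) ?_ ?_ hf.norm ?_
    · exact Filter.Eventually.of_forall fun ε =>
        (Continuous.aestronglyMeasurable (by fun_prop)).mul hf.1
    · filter_upwards [hpos] with ε hε
      refine Filter.Eventually.of_forall fun p => ?_
      rw [norm_mul]
      refine mul_le_of_le_one_left (norm_nonneg _) ?_
      rw [Complex.norm_exp, Real.exp_le_one_iff, ← Complex.ofReal_sub, ← Complex.ofReal_pow,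
        Complex.re_mul_ofReal, Complex.neg_re, hzre]
      nlinarith [mul_nonneg hε.le (sq_nonneg (p - q))]
    · refine Filter.Eventually.of_forall fun p => ?_
      exact ((Complex.continuous_exp.tendsto _).comp (hzt.neg.mul_const _)).mul_const _
  have hR : Filter.Tendsto (fun ε => (Real.pi / z ε) ^ (1 / 2 : ℂ) *
      𝓕⁻ (fun ξ : ℝ => Complex.exp (-(Real.pi * ξ) ^ 2 / z ε) * 𝓕 f ξ) q) (nhdsWithin 0 (Ioi 0))
      (nhds ((Real.pi / (Complex.I * t)) ^ (1 / 2 : ℂ) *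
      𝓕⁻ (fun ξ : ℝ => Complex.exp (-(Real.pi * ξ) ^ 2 / (Complex.I * t)) * 𝓕 f ξ) q)) := by
    refine Filter.Tendsto.mul ?_ ?_
    · have hs : (Real.pi / (Complex.I * t) : ℂ) ∈ Complex.slitPlane := by
        refine Complex.mem_slitPlane_iff.2 (Or.inr ?_)
        have : (Real.pi / (Complex.I * t) : ℂ) = -((Real.pi / t : ℝ) : ℂ) * Complex.I := by
          have : (t : ℂ) ≠ 0 := by exact_mod_cast ht.ne'
          push_cast
          field_simp
          simp
        rw [this]
        simp [Real.pi_ne_zero, ht.ne']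
      exact (continuousAt_cpow_const hs).tendsto.comp (tendsto_const_nhds.div hzt hz0)
    · simp only [Real.fourierInv_eq']
      refine tendsto_integral_filter_of_dominated_convergence (fun p => ‖𝓕 f p‖) ?_ ?_ hf'.norm ?_
      · refine Filter.Eventually.of_forall fun ε => ?_
        have h₁ : Continuous fun ξ : ℝ =>
            Complex.exp (↑(2 * Real.pi * inner ℝ ξ q) * Complex.I) := by fun_prop
        have h₂ : Continuous fun ξ : ℝ => Complex.exp (-(Real.pi * ξ) ^ 2 / z ε) := by fun_prop
        exact h₁.aestronglyMeasurable.smul (h₂.aestronglyMeasurable.mul hf'.1)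
      · filter_upwards [hpos] with ε hε
        refine Filter.Eventually.of_forall fun ξ => ?_
        rw [norm_smul, Complex.norm_exp_ofReal_mul_I, one_mul, norm_mul]
        refine mul_le_of_le_one_left (norm_nonneg _) ?_
        have := norm_exp_neg_sq_div_le (z := z ε) (by rw [hzre]; exact hε.le) (Real.pi * ξ)
        simpa using this
      · refine Filter.Eventually.of_forall fun ξ => ?_
        exact (((Complex.continuous_exp.tendsto _).comp
          (tendsto_const_nhds.div hzt hz0)).mul_const _).const_smul _
  refine tendsto_nhds_unique (hL.congr' ?_) hR
  filter_upwards [hpos] with ε hε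
  exact gaussianConv_eq_fourierInv_of_re_pos (by rw [hzre]; exact hε) hf q

theorem norm_exp_I_mul_sub_one_le_two_mul_sqrt (x : ℝ) :
    ‖Complex.exp (Complex.I * x) - 1‖ ≤ 2 * √|x| := by
  have h₁ : ‖Complex.exp (Complex.I * x) - 1‖ ≤ |x| := Real.norm_exp_I_mul_ofReal_sub_one_le
  have h₂ : ‖Complex.exp (Complex.I * x) - 1‖ ≤ 2 := by
    refine (norm_sub_le _ _).trans ?_
    rw [mul_comm, Complex.norm_exp_ofReal_mul_I]
    norm_num
  have h3 := Real.sq_sqrt (abs_nonneg x)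
  have h4 := Real.sqrt_nonneg |x|
  rcases le_total (√|x|) 1 with h | h <;> nlinarith

theorem norm_fresnel_factor {t : ℝ} (ht : 0 < t) :
    ‖(Real.pi / (Complex.I * t) : ℂ) ^ (1 / 2 : ℂ)‖ = √(Real.pi / t) := by
  have hn : ‖(Real.pi / (Complex.I * t) : ℂ)‖ = Real.pi / t := by
    rw [norm_div, norm_mul, Complex.norm_I, one_mul, Complex.norm_real, Complex.norm_real,
      Real.norm_of_nonneg Real.pi_pos.le, Real.norm_of_nonneg ht.le]
  have := Complex.norm_cpow_real (Real.pi / (Complex.I * t) : ℂ) (1 / 2)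
  rw [hn, ← Real.sqrt_eq_rpow] at this
  rw [← this]
  norm_num

/-- The Fourier transform of an `H¹` function is integrable. -/
theorem integrable_fourier_of_memLp {f : ℝ → ℂ} (hf : Integrable f) (hf₂ : MemLp f 2)
    (hd : MemLp (fun ξ : ℝ => ξ * 𝓕 f ξ) 2) : Integrable (𝓕 f) := by
  have h₁ : MemLp (fun ξ : ℝ => (1 + |ξ| : ℝ) * ‖𝓕 f ξ‖) 2 := by
    have := (memLp_fourier hf hf₂).norm.add hd.norm
    refine (memLp_congr_ae (Filter.Eventually.of_forall fun ξ => ?_)).1 this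
    simp
    ring
  have h₂ : MemLp (fun ξ : ℝ => (1 + |ξ|)⁻¹) 2 := by
    have hc : Continuous fun ξ : ℝ => (1 + |ξ|)⁻¹ :=
      Continuous.inv₀ (by fun_prop) fun ξ => by positivity
    rw [memLp_two_iff_integrable_sq hc.aestronglyMeasurable]
    refine integrable_inv_one_add_sq.mono' (by fun_prop) (Filter.Eventually.of_forall fun ξ => ?_)
    rw [Real.norm_of_nonneg (by positivity), inv_pow]
    gcongr
    nlinarith [abs_nonneg ξ, sq_abs ξ]
  have h₃ : Integrable fun ξ : ℝ => (1 + |ξ|)⁻¹ * ((1 + |ξ| : ℝ) * ‖𝓕 f ξ‖) :=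
    h₂.integrable_mul h₁
  refine (integrable_norm_iff (continuous_fourier_of_integrable hf).aestronglyMeasurable).1 ?_
  refine h₃.congr (Filter.Eventually.of_forall fun ξ => ?_)
  have : (1 + |ξ|) ≠ 0 := by positivity
  simp only
  field_simp

/-- The leading term of the stationary phase method for `H¹` amplitudes, in `L²` of the stationary
point: the error is of order `t⁻¹`, a factor `t^{-1/2}` better than the leading term. -/
theorem eLpNorm_gaussianConv_sub_le {f : ℝ → ℂ} (hc : Continuous f) (hf : Integrable f)
    (hf₂ : MemLp f 2) (hd : MemLp (fun ξ : ℝ => ξ * 𝓕 f ξ) 2) :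
    ∃ C : ℝ, 0 ≤ C ∧ ∀ t : ℝ, 0 < t →
      eLpNorm (fun q => gaussianConv (Complex.I * t) f q -
        (Real.pi / (Complex.I * t) : ℂ) ^ (1 / 2 : ℂ) * f q) 2 volume ≤
        ENNReal.ofReal (C * t⁻¹) := by
  have hF := integrable_fourier_of_memLp hf hf₂ hd
  have hF2 := memLp_fourier hf hf₂
  set D : ℝ := (eLpNorm (fun ξ : ℝ => ξ * 𝓕 f ξ) 2 volume).toReal with hD
  refine ⟨√Real.pi * (2 * Real.pi) * D, by positivity, fun t ht => ?_⟩
  set r : ℝ → ℂ := fun ξ =>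
    (Complex.exp (-(Real.pi * ξ) ^ 2 / (Complex.I * t)) - 1) * 𝓕 f ξ with hr
  have hexp : ∀ ξ : ℝ, (-(Real.pi * ξ) ^ 2 / (Complex.I * t) : ℂ) =
      Complex.I * (((Real.pi * ξ) ^ 2 / t : ℝ) : ℂ) := by
    intro ξ
    have : (t : ℂ) ≠ 0 := by exact_mod_cast ht.ne'
    push_cast
    field_simp
    simp
  have hmeas : AEStronglyMeasurable
      (fun ξ : ℝ => Complex.exp (-(Real.pi * ξ) ^ 2 / (Complex.I * t))) volume :=
    Continuous.aestronglyMeasurable (by fun_prop)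
  have h1 : ∀ ξ : ℝ, ‖Complex.exp (-(Real.pi * ξ) ^ 2 / (Complex.I * t))‖ ≤ 1 := by
    intro ξ
    rw [hexp, mul_comm, Complex.norm_exp_ofReal_mul_I]
  have hEF : Integrable fun ξ : ℝ =>
      Complex.exp (-(Real.pi * ξ) ^ 2 / (Complex.I * t)) * 𝓕 f ξ :=
    hF.bdd_mul hmeas (Filter.Eventually.of_forall h1)
  have hrle : ∀ ξ, ‖r ξ‖ ≤ (2 * Real.pi * √(t⁻¹)) * ‖(ξ * 𝓕 f ξ : ℂ)‖ := by
    intro ξ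
    rw [hr, norm_mul, norm_mul, ← mul_assoc]
    refine mul_le_mul_of_nonneg_right ?_ (norm_nonneg _)
    rw [hexp]
    refine (norm_exp_I_mul_sub_one_le_two_mul_sqrt _).trans (le_of_eq ?_)
    rw [abs_of_nonneg (by positivity), div_eq_mul_inv, Real.sqrt_mul (by positivity),
      Real.sqrt_sq_eq_abs, abs_mul, abs_of_pos Real.pi_pos, Complex.norm_real, Real.norm_eq_abs]
    ring
  have hrm : AEStronglyMeasurable r volume :=
    (hmeas.sub aestronglyMeasurable_const).mul hF.1
  have hr1 : Integrable r := by
    refine (hEF.sub hF).congr (Filter.Eventually.of_forall fun ξ => ?_)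
    simp only [hr, Pi.sub_apply]
    ring
  have hr2 : MemLp r 2 := hd.of_le_mul hrm (Filter.Eventually.of_forall hrle)
  have hfun : (fun q => gaussianConv (Complex.I * t) f q -
        (Real.pi / (Complex.I * t) : ℂ) ^ (1 / 2 : ℂ) * f q) =
      ((Real.pi / (Complex.I * t) : ℂ) ^ (1 / 2 : ℂ)) • 𝓕⁻ r := by
    ext q
    have hinv : 𝓕⁻ (𝓕 f) q = f q := by rw [hc.fourierInv_fourier_eq hf hF]
    rw [gaussianConv_eq_fourierInv ht hf hF, Pi.smul_apply, smul_eq_mul, ← mul_sub]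
    congr 1
    rw [← hinv, Real.fourierInv_eq', Real.fourierInv_eq', Real.fourierInv_eq', ← integral_sub]
    · refine integral_congr_ae (Filter.Eventually.of_forall fun ξ => ?_)
      simp only [hr, smul_eq_mul]
      ring
    · exact hEF.bdd_mul (c := 1) (Continuous.aestronglyMeasurable (by fun_prop))
        (Filter.Eventually.of_forall fun ξ => (Complex.norm_exp_ofReal_mul_I _).le)
    · exact hF.bdd_mul (c := 1) (Continuous.aestronglyMeasurable (by fun_prop))
        (Filter.Eventually.of_forall fun ξ => (Complex.norm_exp_ofReal_mul_I _).le)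
  rw [hfun, eLpNorm_const_smul, eLpNorm_fourierInv_eq hr1 hr2, ← ofReal_norm,
    norm_fresnel_factor ht]
  calc _ ≤ ENNReal.ofReal √(Real.pi / t) * (ENNReal.ofReal (2 * Real.pi * √(t⁻¹)) *
        eLpNorm (fun ξ : ℝ => (ξ * 𝓕 f ξ : ℂ)) 2 volume) := by
        gcongr
        exact eLpNorm_le_mul_eLpNorm_of_ae_le_mul (Filter.Eventually.of_forall hrle) 2
    _ = _ := by
        rw [← ENNReal.ofReal_toReal hd.2.ne, ← hD, ← ENNReal.ofReal_mul (by positivity),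
          ← ENNReal.ofReal_mul (by positivity)]
        congr 1
        rw [div_eq_mul_inv, Real.sqrt_mul Real.pi_pos.le]
        have := Real.mul_self_sqrt (inv_pos.2 ht).le
        linear_combination (√Real.pi * (2 * Real.pi) * D) * this

/-! ### Singular amplitudes and piecewise differentiable functions -/

theorem integral_sub_rpow {p₁ c d r : ℝ} (h : -1 < r ∨ r ≠ -1 ∧ (0 : ℝ) ∉ uIcc (c - p₁) (d - p₁)) :
    ∫ p in c..d, (p - p₁) ^ r = ((d - p₁) ^ (r + 1) - (c - p₁) ^ (r + 1)) / (r + 1) := by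
  rw [intervalIntegral.integral_comp_sub_right (fun x : ℝ => x ^ r), integral_rpow h]

/-- An amplitude with a singularity of order `μ - 1` at `p₁` contributes `O(t^{-μ})` to the Fresnel
integral, uniformly for stationary points to the right of the support of the amplitude. -/
theorem norm_integral_fresnel_le {p₁ a μ η K₀ K₁ : ℝ} {B B' : ℝ → ℂ} (ha : p₁ < a) (hμ0 : 0 < μ)
    (hμ1 : μ < 1) (hη : 0 < η) (hB : ContinuousOn B (Ioc p₁ a)) (hB' : ContinuousOn B' (Ioc p₁ a))
    (hd : ∀ p ∈ Ioo p₁ a, HasDerivAt B (B' p) p) (hBi : IntervalIntegrable B volume p₁ a)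
    (h₀ : ∀ p ∈ Ioc p₁ a, ‖B p‖ ≤ K₀ * (p - p₁) ^ (μ - 1))
    (h₁ : ∀ p ∈ Ioc p₁ a, ‖B' p‖ ≤ K₁ * (p - p₁) ^ (μ - 2)) :
    ∃ C : ℝ, 0 ≤ C ∧ ∀ t : ℝ, 1 ≤ t → ∀ q : ℝ, a + η ≤ q →
      ‖∫ p in p₁..a, Complex.exp (-(Complex.I * t) * (p - q) ^ 2) * B p‖ ≤ C * t ^ (-μ) := by
  have hL : 0 < a - p₁ := sub_pos.2 ha
  have hK₀ : 0 ≤ K₀ := by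
    have h := (norm_nonneg _).trans (h₀ a ⟨ha, le_rfl⟩)
    exact nonneg_of_mul_nonneg_left h (Real.rpow_pos_of_pos hL _)
  have hK₁ : 0 ≤ K₁ := by
    have h := (norm_nonneg _).trans (h₁ a ⟨ha, le_rfl⟩)
    exact nonneg_of_mul_nonneg_left h (Real.rpow_pos_of_pos hL _)
  set L := a - p₁ with hLdef
  set K : ℝ := K₁ / η + K₀ * L / η ^ 2 with hK
  have hKn : 0 ≤ K := by positivity
  have h1μ : 0 < 1 - μ := by linarith
  refine ⟨K₀ * L ^ μ / μ + K₀ * L ^ (μ - 1) / η + K * L ^ (μ - 1) / (1 - μ), by positivity,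
    fun t ht q hq => ?_⟩
  have ht0 : 0 < t := by linarith
  have htc : (t : ℂ) ≠ 0 := by exact_mod_cast ht0.ne'
  -- Within distance `L / t` of the singularity the amplitude is bounded by its absolute value;
  -- this scale balances the two contributions.
  set δ := L / t with hδ
  have hδ0 : 0 < δ := by positivity
  have hδL : δ ≤ L := div_le_self hL.le ht
  set c := p₁ + δ with hc
  have hcp : p₁ < c := by linarith
  have hca : c ≤ a := by linarith
  have hsub : Icc c a ⊆ Ioc p₁ a := fun p hp => ⟨hcp.trans_le hp.1, hp.2⟩
  set e : ℝ → ℂ := fun p => Complex.exp (-(Complex.I * t) * (p - q) ^ 2) with he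
  have hecont : Continuous e := by fun_prop
  have hen : ∀ p, ‖e p‖ = 1 := by
    intro p
    have : -(Complex.I * t) * (p - q : ℂ) ^ 2 = ((-(t * (p - q) ^ 2) : ℝ) : ℂ) * Complex.I := by
      push_cast; ring
    rw [he]
    simp only [this, Complex.norm_exp_ofReal_mul_I]
  have heB : IntervalIntegrable (fun p => e p * B p) volume p₁ a :=
    hBi.continuousOn_mul hecont.continuousOn
  have hδμ : δ ^ μ = L ^ μ * t ^ (-μ) := by
    rw [hδ, Real.div_rpow hL.le ht0.le, Real.rpow_neg ht0.le, div_eq_mul_inv]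
  have hδμ1 : δ ^ (μ - 1) * t⁻¹ = L ^ (μ - 1) * t ^ (-μ) := by
    rw [hδ, Real.div_rpow hL.le ht0.le, div_eq_mul_inv, mul_assoc, ← Real.rpow_neg ht0.le,
      ← Real.rpow_neg_one t, ← Real.rpow_add ht0]
    congr 2
    ring
  have hnear : ‖∫ p in p₁..c, e p * B p‖ ≤ K₀ * L ^ μ / μ * t ^ (-μ) := by
    have hi : IntervalIntegrable (fun p : ℝ => K₀ * (p - p₁) ^ (μ - 1)) volume p₁ c := by
      have := (intervalIntegral.intervalIntegrable_rpow' (r := μ - 1) (by linarith)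
        (a := 0) (b := δ)).comp_sub_right p₁
      simp only [zero_add] at this
      rw [hc, add_comm]
      exact this.const_mul K₀
    calc _ ≤ ∫ p in p₁..c, K₀ * (p - p₁) ^ (μ - 1) := by
          refine intervalIntegral.norm_integral_le_of_norm_le hcp.le
            (Filter.Eventually.of_forall fun p hp => ?_) hi
          rw [norm_mul, hen, one_mul]
          exact h₀ p ⟨hp.1, hp.2.trans hca⟩
      _ = K₀ * L ^ μ / μ * t ^ (-μ) := by
          rw [intervalIntegral.integral_const_mul, integral_sub_rpow (Or.inl (by linarith))]
          simp only [sub_self, sub_add_cancel, hc, add_sub_cancel_left, Real.zero_rpow hμ0.ne',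
            sub_zero, hδμ]
          ring
  -- Away from the singularity, integrate by parts against the non-stationary phase.
  set h : ℝ → ℂ := fun p => B p / (-2 * Complex.I * t * (p - q)) with hh
  set h' : ℝ → ℂ := fun p => B' p / (-2 * Complex.I * t * (p - q)) -
    B p / (-2 * Complex.I * t * (p - q) ^ 2) with hh'
  have hpq : ∀ p ∈ Icc c a, η ≤ q - p := fun p hp => by linarith [hp.2]
  have hpqc : ∀ p ∈ Icc c a, (p - q : ℂ) ≠ 0 := by
    intro p hp
    have := hpq p hp
    have h3 : p - q ≠ 0 := by linarith
    exact_mod_cast h3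
  have hden : ∀ p ∈ Icc c a, (-2 * Complex.I * t * (p - q) : ℂ) ≠ 0 := fun p hp => by
    simp [htc, hpqc p hp]
  have hden2 : ∀ p ∈ Icc c a, (-2 * Complex.I * t * (p - q) ^ 2 : ℂ) ≠ 0 := fun p hp => by
    simp [htc, hpqc p hp]
  have hcB : ContinuousOn B (Icc c a) := hB.mono hsub
  have hcB' : ContinuousOn B' (Icc c a) := hB'.mono hsub
  have hch : ContinuousOn h (Icc c a) :=
    hcB.div (Continuous.continuousOn (by fun_prop)) hden
  have hch' : ContinuousOn h' (Icc c a) :=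
    (hcB'.div (Continuous.continuousOn (by fun_prop)) hden).sub
      (hcB.div (Continuous.continuousOn (by fun_prop)) hden2)
  have hFd : ∀ p ∈ Ioo c a, HasDerivAt (fun p => e p * h p) (e p * B p + e p * h' p) p := by
    intro p hp
    have hp' : p ∈ Icc c a := Ioo_subset_Icc_self hp
    have hl : HasDerivAt (fun x : ℝ => (x - q : ℂ)) 1 p := by
      simpa using (Complex.ofRealCLM.hasDerivAt (x := p)).sub_const (q : ℂ)
    have hde : HasDerivAt e (e p * (-(Complex.I * t) * (2 * (p - q)))) p := by
      have := ((hl.pow 2).const_mul (-(Complex.I * t))).cexp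
      simpa [he] using this
    have hdh : HasDerivAt h (h' p) p := by
      have := (hd p ⟨hcp.trans hp.1, hp.2⟩).div (hl.const_mul (-2 * Complex.I * t)) (hden p hp')
      refine this.congr_deriv ?_
      have := hpqc p hp'
      simp only [hh']
      field_simp
    refine (hde.mul hdh).congr_deriv ?_
    have := hpqc p hp'
    simp only [hh]
    field_simp
  have hi1 : IntervalIntegrable (fun p => e p * B p) volume c a :=
    (hecont.continuousOn.mul hcB).intervalIntegrable_of_Icc hca
  have hi2 : IntervalIntegrable (fun p => e p * h' p) volume c a :=
    (hecont.continuousOn.mul hch').intervalIntegrable_of_Icc hca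
  have hFTC := intervalIntegral.integral_eq_sub_of_hasDerivAt_of_le hca
    (hecont.continuousOn.mul hch) hFd (hi1.add hi2)
  rw [intervalIntegral.integral_add hi1 hi2] at hFTC
  have hnden : ∀ p ∈ Icc c a, ‖(-2 * Complex.I * t * (p - q) : ℂ)‖ = 2 * t * (q - p) := by
    intro p hp
    have := hpq p hp
    rw [← Complex.ofReal_sub]
    simp only [norm_mul, norm_neg, Complex.norm_I, Complex.norm_real, Complex.norm_ofNat]
    rw [Real.norm_of_nonneg ht0.le, Real.norm_eq_abs, abs_sub_comm, abs_of_nonneg (by linarith)]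
    ring
  have hnden2 : ∀ p ∈ Icc c a, ‖(-2 * Complex.I * t * (p - q) ^ 2 : ℂ)‖ = 2 * t * (q - p) ^ 2 := by
    intro p hp
    have := hpq p hp
    rw [pow_two, ← mul_assoc, norm_mul, hnden p hp, ← Complex.ofReal_sub, Complex.norm_real,
      Real.norm_eq_abs, abs_sub_comm, abs_of_nonneg (by linarith)]
    ring
  have hF : ∀ p ∈ Icc c a, ‖e p * h p‖ ≤ K₀ * L ^ (μ - 1) / η * t ^ (-μ) / 2 := by
    intro p hp
    have h5 := hpq p hp
    rw [norm_mul, hen, one_mul, hh, norm_div, hnden p hp]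
    calc _ ≤ K₀ * δ ^ (μ - 1) / (2 * t * η) := by
          have h6 : (p - p₁) ^ (μ - 1) ≤ δ ^ (μ - 1) :=
            Real.rpow_le_rpow_of_nonpos hδ0 (by linarith [hp.1]) (by linarith)
          have h7 := h₀ p (hsub hp)
          gcongr
          exact h7.trans (by gcongr)
      _ = K₀ * (δ ^ (μ - 1) * t⁻¹) / η / 2 := by field_simp
      _ = _ := by rw [hδμ1]; ring
  have hrest : ‖∫ p in c..a, e p * h' p‖ ≤ K * L ^ (μ - 1) / (1 - μ) * t ^ (-μ) := by
    have hi : IntervalIntegrable (fun p : ℝ => K / (2 * t) * (p - p₁) ^ (μ - 2)) volume c a := by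
      refine ContinuousOn.intervalIntegrable_of_Icc hca (continuousOn_const.mul ?_)
      refine ContinuousOn.rpow_const (by fun_prop) fun p hp => Or.inl ?_
      have := (hsub hp).1
      linarith
    have hle : ∀ p ∈ Icc c a, ‖e p * h' p‖ ≤ K / (2 * t) * (p - p₁) ^ (μ - 2) := by
      intro p hp
      have h5 := hpq p hp
      have hpp : 0 < p - p₁ := by linarith [(hsub hp).1]
      rw [norm_mul, hen, one_mul]
      refine (norm_sub_le _ _).trans ?_
      rw [norm_div, norm_div, hnden p hp, hnden2 p hp]
      have h6 : ‖B p‖ ≤ K₀ * L * (p - p₁) ^ (μ - 2) := by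
        refine (h₀ p (hsub hp)).trans ?_
        have : (p - p₁) ^ (μ - 1) = (p - p₁) * (p - p₁) ^ (μ - 2) := by
          rw [← Real.rpow_one_add' hpp.le (by linarith)]
          congr 1; ring
        rw [this, ← mul_assoc]
        gcongr
        linarith [hp.2]
      calc _ ≤ K₁ * (p - p₁) ^ (μ - 2) / (2 * t * η) +
            K₀ * L * (p - p₁) ^ (μ - 2) / (2 * t * η ^ 2) := by
            have := h₁ p (hsub hp)
            gcongr
        _ = _ := by rw [hK]; field_simp
    calc _ ≤ ∫ p in c..a, K / (2 * t) * (p - p₁) ^ (μ - 2) :=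
          intervalIntegral.norm_integral_le_of_norm_le hca
            (Filter.Eventually.of_forall fun p hp => hle p (Ioc_subset_Icc_self hp)) hi
      _ = K / (2 * t) * ((δ ^ (μ - 1) - L ^ (μ - 1)) / (1 - μ)) := by
          rw [intervalIntegral.integral_const_mul, integral_sub_rpow]
          · have h8 : μ - 2 + 1 = μ - 1 := by ring
            rw [h8, ← hLdef, hc, add_sub_cancel_left, ← neg_sub μ 1, div_neg, ← neg_div, neg_sub]
          · refine Or.inr ⟨by linarith, ?_⟩
            rw [uIcc_of_le (by linarith)]
            intro h0
            linarith [h0.1]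
      _ ≤ K / t * (δ ^ (μ - 1) / (1 - μ)) := by
          have := Real.rpow_nonneg hL.le (μ - 1)
          have h9 : K / (2 * t) ≤ K / t := by gcongr; linarith
          have h10 : δ ^ (μ - 1) - L ^ (μ - 1) ≤ δ ^ (μ - 1) := by linarith
          have h11 : L ^ (μ - 1) ≤ δ ^ (μ - 1) :=
            Real.rpow_le_rpow_of_nonpos hδ0 hδL (by linarith)
          have h12 : 0 ≤ (δ ^ (μ - 1) - L ^ (μ - 1)) / (1 - μ) :=
            div_nonneg (by linarith) h1μ.le
          gcongr
      _ = K * (δ ^ (μ - 1) * t⁻¹) / (1 - μ) := by ring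
      _ = _ := by rw [hδμ1]; ring
  have hfar : ‖∫ p in c..a, e p * B p‖ ≤
      (K₀ * L ^ (μ - 1) / η + K * L ^ (μ - 1) / (1 - μ)) * t ^ (-μ) := by
    have heq : ∫ p in c..a, e p * B p = e a * h a - e c * h c - ∫ p in c..a, e p * h' p :=
      eq_sub_of_add_eq hFTC
    rw [heq]
    have h1 := hF a ⟨hca, le_rfl⟩
    have h2 := hF c ⟨le_rfl, hca⟩
    refine (norm_sub_le _ _).trans ((add_le_add_left (norm_sub_le _ _) _).trans ?_)
    linarith
  have hsplit := intervalIntegral.integral_add_adjacent_intervals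
    (heB.mono_set (by
      rw [uIcc_of_le hcp.le, uIcc_of_le ha.le]; exact Icc_subset_Icc_right hca)) hi1
  rw [← hsplit]
  refine (norm_add_le _ _).trans ((add_le_add hnear hfar).trans (le_of_eq ?_))
  ring

/-- The Fourier transform of the derivative of a continuous, compactly supported function that is
differentiable off a countable set. -/
theorem fourier_eq_mul_fourier_of_hasDerivAt_off_countable {l r : ℝ} (hlr : l ≤ r) {f d : ℝ → ℂ}
    {s : Set ℝ} (hs : s.Countable) (hf : Continuous f) (hf0 : ∀ p, p ∉ Ioo l r → f p = 0)
    (hfd : ∀ p ∈ Ioo l r \ s, HasDerivAt f (d p) p) (hd : Integrable d)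
    (hd0 : ∀ p, p ∉ Ioc l r → d p = 0) (ξ : ℝ) :
    𝓕 d ξ = 2 * Real.pi * Complex.I * ξ * 𝓕 f ξ := by
  set k : ℂ := -2 * Real.pi * Complex.I * ξ with hk
  set e : ℝ → ℂ := fun p => Complex.exp (k * p) with he
  have hecont : Continuous e := by fun_prop
  have hF : ∀ g : ℝ → ℂ, (∀ p, p ∉ Ioc l r → g p = 0) → 𝓕 g ξ = ∫ p in l..r, e p * g p := by
    intro g hg
    rw [Real.fourier_real_eq_integral_exp_smul, intervalIntegral.integral_of_le hlr,
      setIntegral_eq_integral_of_forall_compl_eq_zero fun p hp => by rw [hg p hp, mul_zero]]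
    refine integral_congr_ae (Filter.Eventually.of_forall fun p => ?_)
    simp only [he, hk, smul_eq_mul]
    congr 2
    push_cast
    ring
  rw [hF d hd0, hF f fun p hp => hf0 p fun h => hp (Ioo_subset_Ioc_self h)]
  have hi1 : IntervalIntegrable (fun p => e p * d p) volume l r :=
    hd.intervalIntegrable.continuousOn_mul hecont.continuousOn
  have hi2 : IntervalIntegrable (fun p => k * (e p * f p)) volume l r :=
    (continuous_const.mul (hecont.mul hf)).intervalIntegrable _ _
  have h := MeasureTheory.integral_eq_of_hasDerivAt_off_countable_of_le (fun p => e p * f p)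
    (fun p => k * (e p * f p) + e p * d p) hlr hs (hecont.mul hf).continuousOn
    (fun p hp => by
      have h1 : HasDerivAt e (e p * k) p := by
        have := ((Complex.ofRealCLM.hasDerivAt (x := p)).const_mul k).cexp
        simpa [he] using this
      refine (h1.mul (hfd p hp)).congr_deriv ?_
      ring) (hi2.add hi1)
  rw [intervalIntegral.integral_add hi2 hi1, intervalIntegral.integral_const_mul] at h
  simp only [hf0 l (by simp), hf0 r (by simp), mul_zero, sub_zero] at h
  rw [hk] at h
  linear_combination h

/-! ### The stationary phase estimate for a frequency band -/

/-- The amplitude is `C¹` away from `p₁`, with the bounds near `p₁` that its singularity suggests. The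
derivative is continuous up to `p₂`. -/
theorem FrequencyBandCondition.exists_deriv_bounds {p₁ p₂ μ : ℝ} {u₀ : 𝓢'(ℝ, ℂ)} {U : ℝ → ℂ}
    (hp : p₁ < p₂) (h : FrequencyBandCondition p₁ p₂ μ u₀ U) :
    ∃ (V : ℝ → ℂ) (K₀ K₁ : ℝ), ContinuousOn V (Ioc p₁ p₂) ∧
      (∀ p ∈ Ioo p₁ p₂, HasDerivAt U (V p) p) ∧
      (∀ p ∈ Ioo p₁ p₂, ‖U p‖ ≤ K₀ * (p - p₁) ^ (μ - 1)) ∧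
      (∀ p ∈ Ioo p₁ p₂, ‖V p‖ ≤ K₁ * (p - p₁) ^ (μ - 2)) := by
  obtain ⟨v, hv, hUv, -, -⟩ := h.amplitude
  have hUv' : ∀ p ∈ Ioo p₁ p₂, U p = ((p - p₁) ^ (μ - 1) : ℝ) * v p := by
    intro p hp
    rw [hUv p hp, sub_self, Real.rpow_zero, mul_one]
  have hvc : ContinuousOn v (Icc p₁ p₂) := hv.continuousOn
  have hv'c : ContinuousOn (derivWithin v (Icc p₁ p₂)) (Icc p₁ p₂) :=
    hv.continuousOn_derivWithin (uniqueDiffOn_Icc hp) (by simp)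
  have hvd : ∀ p ∈ Ioo p₁ p₂, HasDerivAt v (derivWithin v (Icc p₁ p₂) p) p := fun p hp' =>
    (hv.differentiableOn (by simp) p (Ioo_subset_Icc_self hp')).hasDerivWithinAt.hasDerivAt (Icc_mem_nhds hp'.1 hp'.2)
  set v' := derivWithin v (Icc p₁ p₂)
  set w : ℝ → ℂ := fun p => ((μ - 1 : ℝ) : ℂ) * v p + ((p - p₁ : ℝ) : ℂ) * v' p with hw
  have hwc : ContinuousOn w (Icc p₁ p₂) :=
    (continuousOn_const.mul hvc).add ((Continuous.continuousOn (by fun_prop)).mul hv'c)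
  obtain ⟨K₀, hK₀⟩ := isCompact_Icc.exists_bound_of_continuousOn hvc
  obtain ⟨K₁, hK₁⟩ := isCompact_Icc.exists_bound_of_continuousOn hwc
  have hpos : ∀ p ∈ Ioo p₁ p₂, 0 < p - p₁ := fun p hp => sub_pos.2 hp.1
  refine ⟨fun p => ((p - p₁) ^ (μ - 2) : ℝ) * w p, K₀, K₁, ?_, ?_, ?_, ?_⟩
  · refine ContinuousOn.mul (Complex.continuous_ofReal.comp_continuousOn ?_)
      (hwc.mono Ioc_subset_Icc_self)
    exact ContinuousOn.rpow_const (by fun_prop) fun p hp => Or.inl (sub_pos.2 hp.1).ne'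
  · intro p hp
    have h1 : HasDerivAt (fun x : ℝ => (x - p₁) ^ (μ - 1)) ((μ - 1) * (p - p₁) ^ (μ - 2)) p := by
      have := ((hasDerivAt_id p).sub_const p₁).rpow_const (p := μ - 1) (Or.inl (hpos p hp).ne')
      refine this.congr_deriv ?_
      simp only [id_eq, one_mul]
      congr 2
      ring
    have h2 := (h1.ofReal_comp.mul (hvd p hp))
    have h3 : U =ᶠ[nhds p] fun x => ((x - p₁) ^ (μ - 1) : ℝ) * v x := by
      filter_upwards [isOpen_Ioo.mem_nhds hp] with x hx using hUv' x hx
    refine (h2.congr_of_eventuallyEq h3).congr_deriv ?_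
    have h4 : (p - p₁) ^ (μ - 1) = (p - p₁) ^ (μ - 2) * (p - p₁) := by
      rw [← Real.rpow_add_one (hpos p hp).ne']
      congr 1; ring
    simp only [hw, h4]
    push_cast
    ring
  · intro p hp
    rw [hUv' p hp, norm_mul, Complex.norm_real,
      Real.norm_of_nonneg (Real.rpow_nonneg (hpos p hp).le _), mul_comm]
    exact mul_le_mul_of_nonneg_right (hK₀ p (Ioo_subset_Icc_self hp))
      (Real.rpow_nonneg (hpos p hp).le _)
  · intro p hp
    rw [norm_mul, Complex.norm_real,
      Real.norm_of_nonneg (Real.rpow_nonneg (hpos p hp).le _), mul_comm]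
    exact mul_le_mul_of_nonneg_right (hK₁ p (Ioo_subset_Icc_self hp))
      (Real.rpow_nonneg (hpos p hp).le _)

/-- A singularity of order `μ - 1` is square integrable for `μ > 1 / 2`. -/
theorem FrequencyBandCondition.memLp_two {p₁ p₂ μ : ℝ} {u₀ : 𝓢'(ℝ, ℂ)} {U : ℝ → ℂ}
    (hp : p₁ < p₂) (hμ : 1 / 2 < μ) (h : FrequencyBandCondition p₁ p₂ μ u₀ U) : MemLp U 2 := by
  obtain ⟨-, K₀, -, -, -, hK, -⟩ := h.exists_deriv_bounds hp
  have hae : U =ᵐ[volume] (Ioo p₁ p₂).indicator U := by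
    have h1 : ∀ᵐ p ∂(volume : Measure ℝ), p ≠ p₁ := by simp [ae_iff]
    filter_upwards [h1] with p hp1
    by_cases hp' : p ∈ Ioo p₁ p₂
    · rw [indicator_of_mem hp']
    · rw [indicator_of_notMem hp']
      by_cases h2 : p ∈ Icc p₁ p₂
      · have h3 : p = p₂ := by
          by_contra h3
          exact hp' ⟨lt_of_le_of_ne h2.1 (Ne.symm hp1), lt_of_le_of_ne h2.2 h3⟩
        rw [h3, h.eq_zero_right]
      · exact h.eq_zero_outside p h2
  rw [memLp_congr_ae hae, memLp_indicator_iff_restrict measurableSet_Ioo]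
  have hm : AEStronglyMeasurable U (volume.restrict (Ioo p₁ p₂)) :=
    (h.continuousOn.mono Ioo_subset_Ioc_self).aestronglyMeasurable measurableSet_Ioo
  rw [memLp_two_iff_integrable_sq_norm hm]
  have hi : IntegrableOn (fun p : ℝ => K₀ ^ 2 * (p - p₁) ^ (2 * (μ - 1))) (Ioo p₁ p₂) := by
    have := (intervalIntegral.intervalIntegrable_rpow' (r := 2 * (μ - 1)) (by linarith)
      (a := 0) (b := p₂ - p₁)).comp_sub_right p₁
    simp only [zero_add, sub_add_cancel] at this
    exact (intervalIntegrable_iff_integrableOn_Ioo_of_le hp.le).1 (this.const_mul _)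
  refine hi.mono' (hm.norm.pow 2) ?_
  filter_upwards [ae_restrict_mem measurableSet_Ioo] with p hp'
  have h0 : 0 < p - p₁ := sub_pos.2 hp'.1
  rw [Real.norm_of_nonneg (by positivity)]
  calc ‖U p‖ ^ 2 ≤ (K₀ * (p - p₁) ^ (μ - 1)) ^ 2 := by
        gcongr
        exact hK p hp'
    _ = _ := by
        rw [mul_pow, ← Real.rpow_natCast ((p - p₁) ^ (μ - 1)), ← Real.rpow_mul h0.le]
        congr 2
        push_cast
        ring

theorem FrequencyBandCondition.integrable {p₁ p₂ μ : ℝ} {u₀ : 𝓢'(ℝ, ℂ)} {U : ℝ → ℂ}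
    (hp : p₁ < p₂) (hμ : 1 / 2 < μ) (h : FrequencyBandCondition p₁ p₂ μ u₀ U) : Integrable U :=
  memLp_one_iff_integrable.1 ((h.memLp_two hp hμ).mono_exponent_of_measure_support_ne_top
    (s := Icc p₁ p₂) h.eq_zero_outside (by simp) (by norm_num))

theorem norm_fresnel_kernel (t p q : ℝ) :
    ‖Complex.exp (-(Complex.I * t) * (p - q) ^ 2)‖ = 1 := by
  have : -(Complex.I * t) * (p - q : ℂ) ^ 2 = ((-(t * (p - q) ^ 2) : ℝ) : ℂ) * Complex.I := by
    push_cast; ring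
  rw [this, Complex.norm_exp_ofReal_mul_I]

theorem integrable_fresnel_kernel_mul {f : ℝ → ℂ} (hf : Integrable f) (t q : ℝ) :
    Integrable fun p : ℝ => Complex.exp (-(Complex.I * t) * (p - q) ^ 2) * f p :=
  hf.bdd_mul (c := 1) (Continuous.aestronglyMeasurable (by fun_prop))
    (Filter.Eventually.of_forall fun p => (norm_fresnel_kernel t p q).le)

theorem continuous_gaussianConv_I_mul {f : ℝ → ℂ} (hf : Integrable f) (t : ℝ) :
    Continuous (gaussianConv (Complex.I * t) f) := by
  refine continuous_of_dominated (bound := fun p => ‖f p‖)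
    (fun q => (integrable_fresnel_kernel_mul hf t q).1) (fun q => ?_) hf.norm ?_
  · refine Filter.Eventually.of_forall fun p => ?_
    rw [norm_mul, norm_fresnel_kernel, one_mul]
  · exact Filter.Eventually.of_forall fun p => by fun_prop

/-- The stationary phase estimate in `L²` of the stationary point, on compact sets to the right of
the singularity of the amplitude. -/
theorem FrequencyBandCondition.eLpNorm_gaussianConv_sub_le {p₁ p₂ μ : ℝ} {u₀ : 𝓢'(ℝ, ℂ)}
    {U : ℝ → ℂ} (hp : p₁ < p₂) (hμ : μ ∈ Ioo (1 / 2 : ℝ) 1)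
    (h : FrequencyBandCondition p₁ p₂ μ u₀ U) {a η β : ℝ} (ha : a ∈ Ioo p₁ p₂) (hη : 0 < η) :
    ∃ C : ℝ, 0 ≤ C ∧ ∀ t : ℝ, 1 ≤ t →
      eLpNorm (fun q => gaussianConv (Complex.I * t) U q -
        (Real.pi / (Complex.I * t) : ℂ) ^ (1 / 2 : ℂ) * U q) 2
        (volume.restrict (Icc (a + η) β)) ≤ ENNReal.ofReal (C * t ^ (-μ)) := by
  obtain ⟨V, K₀, K₁, hVc, hUV, hK₀, hK₁⟩ := h.exists_deriv_bounds hp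
  have hUi : Integrable U := h.integrable hp hμ.1
  have hL : 0 < a - p₁ := sub_pos.2 ha.1
  set L := a - p₁ with hLdef
  -- `A` agrees with `U` to the right of `a`, and is linear on `[p₁, a]`.
  set A : ℝ → ℂ := fun p => U (max p a) * ((max 0 (min 1 ((p - p₁) / L)) : ℝ) : ℂ) with hA
  have hA_left : ∀ p, p ≤ p₁ → A p = 0 := by
    intro p hp
    have : (p - p₁) / L ≤ 0 := div_nonpos_of_nonpos_of_nonneg (by linarith) hL.le
    simp only [hA, max_eq_left ((min_le_right _ _).trans this), Complex.ofReal_zero, mul_zero]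
  have hA_mid : ∀ p ∈ Icc p₁ a, A p = U a * (((p - p₁) / L : ℝ) : ℂ) := by
    intro p hp
    have h1 : 0 ≤ (p - p₁) / L := div_nonneg (by linarith [hp.1]) hL.le
    have h2 : (p - p₁) / L ≤ 1 := (div_le_one hL).2 (by linarith [hp.2])
    simp only [hA, max_eq_right hp.2, min_eq_right h2, max_eq_right h1]
  have hA_right : ∀ p, a ≤ p → A p = U p := by
    intro p hp
    have h2 : 1 ≤ (p - p₁) / L := (one_le_div hL).2 (by linarith)
    simp only [hA, max_eq_left hp, min_eq_left h2, max_eq_right zero_le_one, Complex.ofReal_one,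
      mul_one]
  have hU_ge : ∀ p, p₂ ≤ p → U p = 0 := by
    intro p hp
    rcases hp.eq_or_lt with rfl | hlt
    · exact h.eq_zero_right
    · exact h.eq_zero_outside p fun hh => absurd hh.2 (not_le.2 hlt)
  have hUc : ContinuousOn U (Ici a) := by
    have h1 : ContinuousOn U (Icc a p₂) :=
      h.continuousOn.mono fun p hp => ⟨ha.1.trans_le hp.1, hp.2⟩
    have h2 : ContinuousOn U (Ici p₂) :=
      (continuousOn_const (c := (0 : ℂ))).congr fun p hp => hU_ge p hp
    rw [← Icc_union_Ici_eq_Ici ha.2.le]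
    exact h1.union_of_isClosed h2 isClosed_Icc isClosed_Ici
  have hAc : Continuous A := by
    refine Continuous.mul ?_ (by fun_prop)
    exact hUc.comp_continuous (by fun_prop) fun p => mem_Ici.2 (le_max_right _ _)
  have hA0 : ∀ p, p ∉ Ioo p₁ p₂ → A p = 0 := by
    intro p hp
    by_cases h1 : p ≤ p₁
    · exact hA_left p h1
    · have h2 : p₂ ≤ p := by
        by_contra h2
        exact hp ⟨not_le.1 h1, not_le.1 h2⟩
      rw [hA_right p (ha.2.le.trans h2), hU_ge p h2]
  have hAs : HasCompactSupport A :=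
    HasCompactSupport.intro isCompact_Icc fun p hp =>
      hA0 p fun hh => hp (Ioo_subset_Icc_self hh)
  have hAi : Integrable A := hAc.integrable_of_hasCompactSupport hAs
  have hA2 : MemLp A 2 := hAc.memLp_of_hasCompactSupport hAs
  set d : ℝ → ℂ := fun p =>
    (Ioc p₁ a).indicator (fun _ => U a / L) p + (Ioc a p₂).indicator V p with hd
  have hd2 : MemLp d 2 := by
    refine MemLp.add ?_ ?_
    · rw [memLp_indicator_iff_restrict measurableSet_Ioc]
      exact memLp_const _
    · rw [memLp_indicator_iff_restrict measurableSet_Ioc]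
      have hc : ContinuousOn V (Icc a p₂) :=
        hVc.mono fun p hp => ⟨ha.1.trans_le hp.1, hp.2⟩
      obtain ⟨K, hK⟩ := isCompact_Icc.exists_bound_of_continuousOn hc
      refine MemLp.of_bound ((hc.mono Ioc_subset_Icc_self).aestronglyMeasurable
        measurableSet_Ioc) K ?_
      filter_upwards [ae_restrict_mem measurableSet_Ioc] with p hp
      exact hK p (Ioc_subset_Icc_self hp)
  have hd0 : ∀ p, p ∉ Ioc p₁ p₂ → d p = 0 := by
    intro p hp
    have h1 : p ∉ Ioc p₁ a := fun hh => hp ⟨hh.1, hh.2.trans ha.2.le⟩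
    have h2 : p ∉ Ioc a p₂ := fun hh => hp ⟨ha.1.trans hh.1, hh.2⟩
    simp [hd, h1, h2]
  have hdi : Integrable d := memLp_one_iff_integrable.1
    (hd2.mono_exponent_of_measure_support_ne_top (s := Ioc p₁ p₂) hd0 (by simp) (by norm_num))
  have hAd : ∀ p ∈ Ioo p₁ p₂ \ {a}, HasDerivAt A (d p) p := by
    rintro p ⟨hp', hpa⟩
    rcases lt_or_gt_of_ne hpa with hlt | hgt
    · have h1 : A =ᶠ[nhds p] fun x => U a * (((x - p₁) / L : ℝ) : ℂ) := by
        filter_upwards [Icc_mem_nhds hp'.1 hlt] with x hx using hA_mid x hx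
      have h2 : HasDerivAt (fun x : ℝ => (x - p₁) / L) (1 / L) p :=
        ((hasDerivAt_id p).sub_const p₁).div_const L
      refine ((h2.ofReal_comp.const_mul (U a)).congr_of_eventuallyEq h1).congr_deriv ?_
      have h3 : p ∈ Ioc p₁ a := ⟨hp'.1, hlt.le⟩
      have h4 : p ∉ Ioc a p₂ := fun hh => absurd hh.1 (not_lt.2 hlt.le)
      simp [hd, h3, h4, div_eq_mul_inv]
    · have h1 : A =ᶠ[nhds p] U := by
        filter_upwards [Ioi_mem_nhds hgt] with x hx using hA_right x (le_of_lt hx)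
      refine ((hUV p hp').congr_of_eventuallyEq h1).congr_deriv ?_
      have h3 : p ∉ Ioc p₁ a := fun hh => absurd hh.2 (not_le.2 hgt)
      have h4 : p ∈ Ioc a p₂ := ⟨hgt, hp'.2.le⟩
      simp [hd, h3, h4]
  have hFd : MemLp (fun ξ : ℝ => ξ * 𝓕 A ξ) 2 := by
    have h1 := (memLp_fourier hdi hd2).const_mul ((2 * Real.pi * Complex.I : ℂ)⁻¹)
    refine (memLp_congr_ae (Filter.Eventually.of_forall fun ξ => ?_)).1 h1
    have h2 := fourier_eq_mul_fourier_of_hasDerivAt_off_countable hp.le (countable_singleton a) hAc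
      hA0 hAd hdi hd0 ξ
    have h3 : (2 * Real.pi * Complex.I : ℂ) ≠ 0 := Complex.two_pi_I_ne_zero
    simp only [h2]
    rw [mul_assoc (2 * Real.pi * Complex.I : ℂ), inv_mul_cancel_left₀ h3]
  obtain ⟨C₁, hC₁, hAest⟩ := _root_.eLpNorm_gaussianConv_sub_le hAc hAi hA2 hFd
  -- The remainder `B = U - A` lives on `[p₁, a]` and carries the singularity.
  have hIoc : ∀ p ∈ Ioc p₁ a, p ∈ Ioo p₁ p₂ := fun p hp => ⟨hp.1, hp.2.trans_lt ha.2⟩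
  obtain ⟨C₂, hC₂, hBest⟩ := norm_integral_fresnel_le (p₁ := p₁) (a := a) (μ := μ) (η := η)
    (K₀ := K₀ + ‖U a‖ * L ^ (1 - μ)) (K₁ := K₁ + ‖U a‖ * L ^ (1 - μ))
    (B := fun p => U p - A p) (B' := fun p => V p - U a / L) ha.1 (by linarith [hμ.1]) hμ.2 hη
    ((h.continuousOn.mono fun p hp => ⟨hp.1, (hIoc p hp).2.le⟩).sub hAc.continuousOn)
    ((hVc.mono fun p hp => ⟨hp.1, (hIoc p hp).2.le⟩).sub continuousOn_const)
    (fun p hp' => by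
      refine ((hUV p (hIoc p (Ioo_subset_Ioc_self hp'))).sub
        (hAd p ⟨hIoc p (Ioo_subset_Ioc_self hp'), hp'.2.ne⟩)).congr_deriv ?_
      have h3 : p ∈ Ioc p₁ a := Ioo_subset_Ioc_self hp'
      have h4 : p ∉ Ioc a p₂ := fun hh => absurd hh.1 (not_lt.2 hp'.2.le)
      simp [hd, h3, h4])
    (hUi.sub hAi).intervalIntegrable
    (fun p hp' => by
      have h0 : 0 < p - p₁ := sub_pos.2 hp'.1
      have hle : p - p₁ ≤ L := by linarith [hp'.2]
      refine (norm_sub_le _ _).trans ?_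
      rw [add_mul]
      refine add_le_add (hK₀ p (hIoc p hp')) ?_
      rw [hA_mid p (Ioc_subset_Icc_self hp'), norm_mul, Complex.norm_real,
        Real.norm_of_nonneg (div_nonneg h0.le hL.le), mul_assoc]
      refine mul_le_mul_of_nonneg_left ?_ (norm_nonneg _)
      calc (p - p₁) / L ≤ 1 := (div_le_one hL).2 hle
        _ = L ^ (1 - μ) * L ^ (μ - 1) := by rw [← Real.rpow_add hL]; simp
        _ ≤ _ := by
          have := Real.rpow_le_rpow_of_nonpos h0 hle (by linarith [hμ.2] : μ - 1 ≤ 0)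
          gcongr)
    (fun p hp' => by
      have h0 : 0 < p - p₁ := sub_pos.2 hp'.1
      have hle : p - p₁ ≤ L := by linarith [hp'.2]
      refine (norm_sub_le _ _).trans ?_
      rw [add_mul]
      refine add_le_add (hK₁ p (hIoc p hp')) ?_
      rw [norm_div, Complex.norm_real, Real.norm_of_nonneg hL.le, mul_assoc, div_eq_mul_inv]
      refine mul_le_mul_of_nonneg_left ?_ (norm_nonneg _)
      calc L⁻¹ = L ^ (1 - μ) * L ^ (μ - 2) := by
            rw [← Real.rpow_add hL, ← Real.rpow_neg_one]; congr 1; ring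
        _ ≤ _ := by
          have := Real.rpow_le_rpow_of_nonpos h0 hle (by linarith [hμ.2] : μ - 2 ≤ 0)
          gcongr)
  set m : ℝ := ((volume.restrict (Icc (a + η) β)) univ ^ (2 : ℝ≥0∞).toReal⁻¹).toReal
  refine ⟨m * C₂ + C₁, by positivity, fun t ht => ?_⟩
  have ht0 : 0 < t := by linarith
  set κ : ℂ := (Real.pi / (Complex.I * t) : ℂ) ^ (1 / 2 : ℂ)
  have hcU := continuous_gaussianConv_I_mul hUi t
  have hcA := continuous_gaussianConv_I_mul hAi t
  have hB : ∀ q, gaussianConv (Complex.I * t) U q - gaussianConv (Complex.I * t) A q =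
      ∫ p in p₁..a, Complex.exp (-(Complex.I * t) * (p - q) ^ 2) * (U p - A p) := by
    intro q
    rw [gaussianConv, gaussianConv, ← integral_sub (integrable_fresnel_kernel_mul hUi t q)
      (integrable_fresnel_kernel_mul hAi t q), intervalIntegral.integral_of_le ha.1.le,
      ← integral_Icc_eq_integral_Ioc,
      setIntegral_eq_integral_of_forall_compl_eq_zero]
    · simp only [mul_sub]
    · intro p hp'
      have : U p - A p = 0 := by
        by_cases h1 : a ≤ p
        · rw [hA_right p h1, sub_self]
        · have h2 : p < p₁ := by
            by_contra h2
            exact hp' ⟨not_lt.1 h2, (not_le.1 h1).le⟩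
          rw [hA_left p h2.le, h.eq_zero_outside p fun hh => absurd hh.1 (not_le.2 h2), sub_zero]
      rw [this, mul_zero]
  calc eLpNorm (fun q => gaussianConv (Complex.I * t) U q - κ * U q) 2
        (volume.restrict (Icc (a + η) β))
      = eLpNorm ((fun q => gaussianConv (Complex.I * t) U q - gaussianConv (Complex.I * t) A q) +
          fun q => gaussianConv (Complex.I * t) A q - κ * A q) 2
          (volume.restrict (Icc (a + η) β)) := by
        refine eLpNorm_congr_ae ?_
        filter_upwards [ae_restrict_mem measurableSet_Icc] with q hq
        rw [Pi.add_apply, hA_right q (by linarith [hq.1])]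
        ring
    _ ≤ _ := eLpNorm_add_le (hcU.sub hcA).aestronglyMeasurable
          (hcA.sub (continuous_const.mul hAc)).aestronglyMeasurable (by norm_num)
    _ ≤ ENNReal.ofReal (m * (C₂ * t ^ (-μ))) + ENNReal.ofReal (C₁ * t⁻¹) := by
        refine add_le_add ?_ ((eLpNorm_mono_measure _ Measure.restrict_le_self).trans (hAest t ht0))
        refine (eLpNorm_le_of_ae_bound (C := C₂ * t ^ (-μ)) ?_).trans (le_of_eq ?_)
        · filter_upwards [ae_restrict_mem measurableSet_Icc] with q hq
          rw [hB q]
          exact hBest t ht q hq.1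
        · rw [ENNReal.ofReal_mul ENNReal.toReal_nonneg, ENNReal.ofReal_toReal]
          exact ENNReal.rpow_ne_top_of_nonneg (by positivity) (measure_ne_top _ _)
    _ ≤ _ := by
        rw [← ENNReal.ofReal_add (by positivity) (by positivity)]
        refine ENNReal.ofReal_le_ofReal ?_
        have : t⁻¹ ≤ t ^ (-μ) := by
          rw [← Real.rpow_neg_one]
          exact Real.rpow_le_rpow_of_exponent_le ht (by linarith [hμ.2])
        have := mul_le_mul_of_nonneg_left this hC₁
        linarith

/-! ### Norms on space-time cones -/

theorem memLp_comp_mul_left {f : ℝ → ℂ} {p : ℝ≥0∞} (hf : MemLp f p) {s : ℝ} (hs : s ≠ 0) :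
    MemLp (fun x => f (s * x)) p := by
  have h := Real.map_volume_mul_left hs
  have hm : MemLp f p (Measure.map (s * ·) volume) := by
    rw [h]
    exact hf.smul_measure ENNReal.ofReal_ne_top
  exact hm.comp_of_map (by fun_prop)

/-- Scaling of the `L²`-norm on intervals. -/
theorem l2NormOn_Icc_mul {s : ℝ} (hs : 0 < s) (α β : ℝ) (f : ℝ → ℂ) :
    l2NormOn (Icc (s * α) (s * β)) f = √s * l2NormOn (Icc α β) (fun q => f (s * q)) := by
  have he : MeasurableEmbedding (fun x : ℝ => s * x) :=
    (Homeomorph.mulLeft₀ s hs.ne').measurableEmbedding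
  have h : (volume : Measure ℝ).restrict (Icc (s * α) (s * β)) =
      ENNReal.ofReal s • Measure.map (fun x : ℝ => s * x) (volume.restrict (Icc α β)) := by
    conv_lhs => rw [← Real.smul_map_volume_mul_left hs.ne', abs_of_pos hs]
    rw [Measure.restrict_smul, he.restrict_map, preimage_const_mul_Icc₀ _ _ hs,
      mul_div_cancel_left₀ _ hs.ne', mul_div_cancel_left₀ _ hs.ne']
  rw [l2NormOn, l2NormOn, h, eLpNorm_smul_measure_of_ne_top (by norm_num),
    he.eLpNorm_map_measure, smul_eq_mul, ENNReal.toReal_mul, ← ENNReal.toReal_rpow,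
    ENNReal.toReal_ofReal hs.le, Real.sqrt_eq_rpow]
  congr 2
  norm_num

theorem l2NormOn_Ioo_eq_Icc (α β : ℝ) (f : ℝ → ℂ) :
    l2NormOn (Ioo α β) f = l2NormOn (Icc α β) f := by
  rw [l2NormOn, l2NormOn, Measure.restrict_congr_set Ioo_ae_eq_Icc]

theorem l2NormOn_eq_mul_of_norm_eq {s : Set ℝ} {f g : ℝ → ℂ} {c : ℝ} (hc : 0 ≤ c)
    (h : ∀ x, ‖f x‖ = c * ‖g x‖) : l2NormOn s f = c * l2NormOn s g := by
  have h1 : eLpNorm f 2 (volume.restrict s) = eLpNorm ((c : ℂ) • g) 2 (volume.restrict s) := by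
    refine eLpNorm_congr_norm_ae (Filter.Eventually.of_forall fun x => ?_)
    rw [h, Pi.smul_apply, norm_smul, Complex.norm_real, Real.norm_of_nonneg hc]
  rw [l2NormOn, l2NormOn, h1, eLpNorm_const_smul, ENNReal.toReal_mul, toReal_enorm,
    Complex.norm_real, Real.norm_of_nonneg hc]

/-- The reverse triangle inequality for `l2NormOn`. Square integrability rules out the junk value `0` of
`l2NormOn` for functions of infinite norm. -/
theorem abs_l2NormOn_sub_le {s : Set ℝ} {f g : ℝ → ℂ} {C : ℝ} (hC : 0 ≤ C)
    (hf : MemLp f 2 (volume.restrict s)) (hg : MemLp g 2 (volume.restrict s))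
    (h : eLpNorm (fun x => f x - g x) 2 (volume.restrict s) ≤ ENNReal.ofReal C) :
    |l2NormOn s f - l2NormOn s g| ≤ C := by
  have h1 := abs_norm_sub_norm_le hf.toLp hg.toLp
  rw [← MemLp.toLp_sub, Lp.norm_toLp, Lp.norm_toLp, Lp.norm_toLp] at h1
  exact h1.trans (ENNReal.toReal_le_of_le_ofReal hC h)

/-- The free evolution at the point `2 t q` is, up to a factor of modulus `(2 π)⁻¹`, the Fresnel
integral of the amplitude with stationary point `q`. -/
theorem norm_fourierInv_phaseEvolution_eq (U : ℝ → ℂ) (t q : ℝ) :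
    ‖𝓕⁻ (phaseEvolution laplaceSymbol (fun ξ => U (2 * Real.pi * ξ)) (-t)) (2 * t * q)‖ =
      (2 * Real.pi)⁻¹ * ‖gaussianConv (Complex.I * t) U q‖ := by
  have h1 : 𝓕⁻ (phaseEvolution laplaceSymbol (fun ξ => U (2 * Real.pi * ξ)) (-t)) (2 * t * q) =
      ∫ ξ : ℝ, (fun p : ℝ => Complex.exp ((t * q ^ 2 : ℝ) * Complex.I) *
        (Complex.exp (-(Complex.I * t) * (p - q) ^ 2) * U p)) (2 * Real.pi * ξ) := by
    rw [Real.fourierInv_eq']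
    refine integral_congr_ae (Filter.Eventually.of_forall fun ξ => ?_)
    simp only [phaseEvolution, laplaceSymbol, smul_eq_mul, ← mul_assoc, ← Complex.exp_add,
      RCLike.inner_apply, conj_trivial]
    congr 2
    push_cast
    ring
  rw [h1, Measure.integral_comp_mul_left (fun p : ℝ => Complex.exp ((t * q ^ 2 : ℝ) * Complex.I) *
    (Complex.exp (-(Complex.I * t) * (p - q) ^ 2) * U p)), integral_const_mul, norm_smul, norm_mul,
    Complex.norm_exp_ofReal_mul_I, one_mul, gaussianConv, Real.norm_eq_abs, abs_abs,
    abs_of_pos (inv_pos.2 Real.two_pi_pos)]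

theorem corollary2p8 (p₁ p₂ μ : ℝ) (hp : p₁ < p₂) (hμ : μ ∈ Ioo (1 / 2 : ℝ) 1)
    (u₀ : 𝓢'(ℝ, ℂ)) (U : ℝ → ℂ) (hu₀ : FrequencyBandCondition p₁ p₂ μ u₀ U) :
    (∃ f : Lp ℂ 2 (volume : Measure ℝ), (f : 𝓢'(ℝ, ℂ)) = u₀) ∧
    (∃ u : ℝ → Lp ℂ 2 (volume : Measure ℝ), IsFreeSchrodingerSolution u₀ u) ∧
    ∀ ε₁ ε₂ : ℝ, 0 < ε₁ → 0 < ε₂ → p₁ + ε₁ < p₂ - ε₂ →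
      ∃ c : ℝ, 0 ≤ c ∧
        ∀ u : ℝ → Lp ℂ 2 (volume : Measure ℝ), IsFreeSchrodingerSolution u₀ u →
          ∀ t : ℝ, 1 ≤ t →
            |l2NormOn (Icc (2 * (p₁ + ε₁) * t) (2 * (p₂ - ε₂) * t)) (u t)
                - (√(2 * Real.pi))⁻¹ * l2NormOn (Ioo (p₁ + ε₁) (p₂ - ε₂)) U|
              ≤ c * t ^ (1 / 2 - μ) := by
  have hU2 : MemLp U 2 := hu₀.memLp_two hp hμ.1
  have hU1 : Integrable U := hu₀.integrable hp hμ.1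
  have hG : MemLp (fun ξ => U (2 * Real.pi * ξ)) 2 :=
    memLp_comp_mul_left hU2 Real.two_pi_pos.ne'
  have hG₁ : Integrable (fun ξ => U (2 * Real.pi * ξ)) :=
    memLp_one_iff_integrable.1
      (memLp_comp_mul_left (memLp_one_iff_integrable.2 hU1) Real.two_pi_pos.ne')
  refine ⟨⟨_, fourierInv_toLp_eq hu₀.fourier hG⟩,
    exists_isFreeSchrodingerSolution (R := max |p₁| |p₂|) hu₀.fourier hG fun p hp0 => ?_,
    fun ε₁ ε₂ hε₁ hε₂ hε => ?_⟩
  · have hpI : p ∈ Icc p₁ p₂ := by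
      by_contra hn
      exact hp0 (hu₀.eq_zero_outside p hn)
    exact abs_le_max_abs_abs hpI.1 hpI.2
  · obtain ⟨C, hC, hest⟩ := hu₀.eLpNorm_gaussianConv_sub_le hp hμ (a := p₁ + ε₁ / 2) (η := ε₁ / 2)
      (β := p₂ - ε₂) ⟨by linarith, by linarith⟩ (by linarith)
    have ha : p₁ + ε₁ / 2 + ε₁ / 2 = p₁ + ε₁ := by ring
    rw [ha] at hest
    set α := p₁ + ε₁
    set β := p₂ - ε₂
    refine ⟨√2 * (2 * Real.pi)⁻¹ * C, by positivity, fun u hu t ht => ?_⟩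
    have ht0 : 0 < t := by linarith
    set κ : ℂ := (Real.pi / (Complex.I * t) : ℂ) ^ (1 / 2 : ℂ) with hκ
    set W := gaussianConv (Complex.I * t) U
    have hWc : Continuous W := continuous_gaussianConv_I_mul hU1 t
    have hu1 : l2NormOn (Icc (2 * α * t) (2 * β * t)) (u t) =
        √(2 * t) * ((2 * Real.pi)⁻¹ * l2NormOn (Icc α β) W) := by
      have h1 := hu.ae_eq_fourierInv hu₀.fourier hG hG₁ ht0.le
      have e1 : 2 * α * t = 2 * t * α := by ring
      have e2 : 2 * β * t = 2 * t * β := by ring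
      rw [l2NormOn, eLpNorm_congr_ae (ae_restrict_of_ae h1), e1, e2]
      refine (l2NormOn_Icc_mul (by positivity) α β _).trans ?_
      rw [l2NormOn_eq_mul_of_norm_eq (by positivity)
        (norm_fourierInv_phaseEvolution_eq U t)]
    have hκU : l2NormOn (Icc α β) (fun q => κ * U q) =
        √(Real.pi / t) * l2NormOn (Icc α β) U :=
      l2NormOn_eq_mul_of_norm_eq (Real.sqrt_nonneg _) fun q => by
        rw [norm_mul, hκ, norm_fresnel_factor ht0]
    -- The normalisation: `√(2 t) (2 π)⁻¹ |κ| = (2 π)^{-1/2}`.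
    have hnorm : (√(2 * Real.pi))⁻¹ = √(2 * t) * (2 * Real.pi)⁻¹ * √(Real.pi / t) := by
      have h1 : √(2 * t) * √(Real.pi / t) = √(2 * Real.pi) := by
        rw [← Real.sqrt_mul (by positivity)]
        congr 1
        field_simp
      have h2 : √(2 * Real.pi) * √(2 * Real.pi) = 2 * Real.pi :=
        Real.mul_self_sqrt (by positivity)
      have h3 : √(2 * Real.pi) ≠ 0 := by positivity
      calc (√(2 * Real.pi))⁻¹ = (2 * Real.pi)⁻¹ * √(2 * Real.pi) := by
            rw [eq_inv_mul_iff_mul_eq₀ Real.two_pi_pos.ne', mul_inv_eq_iff_eq_mul₀ h3]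
            exact h2.symm
        _ = _ := by rw [← h1]; ring
    have hdiff : |l2NormOn (Icc α β) W - l2NormOn (Icc α β) (fun q => κ * U q)| ≤
        C * t ^ (-μ) := by
      refine abs_l2NormOn_sub_le (by positivity) ?_ ((hU2.restrict _).const_mul κ) (hest t ht)
      obtain ⟨K, hK⟩ := isCompact_Icc.exists_bound_of_continuousOn (hWc.continuousOn (s := Icc α β))
      refine MemLp.of_bound hWc.aestronglyMeasurable K ?_
      filter_upwards [ae_restrict_mem measurableSet_Icc] with q hq using hK q hq
    have htpow : √t * t ^ (-μ) = t ^ (1 / 2 - μ) := by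
      rw [Real.sqrt_eq_rpow, ← Real.rpow_add ht0, sub_eq_add_neg]
    calc _ = √(2 * t) * (2 * Real.pi)⁻¹ *
          |l2NormOn (Icc α β) W - l2NormOn (Icc α β) (fun q => κ * U q)| := by
          rw [hu1, hnorm, hκU, l2NormOn_Ioo_eq_Icc,
            ← abs_of_nonneg (show 0 ≤ √(2 * t) * (2 * Real.pi)⁻¹ by positivity), ← abs_mul,
            abs_of_nonneg (show 0 ≤ √(2 * t) * (2 * Real.pi)⁻¹ by positivity)]
          congr 1
          ring
      _ ≤ √(2 * t) * (2 * Real.pi)⁻¹ * (C * t ^ (-μ)) := by gcongr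
      _ = _ := by
          rw [Real.sqrt_mul (by norm_num), ← htpow]
          ring
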